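/- **Setting.** Let $n\in\{2,3\}$. A fractured medium in $\mathbb R^n$ consists of finitely many flat, connected polyhedral subdomains $\Omega_i$ of dimensions $d_i\in\{0,\dots,n\}$ (rock, fractures, intersections), and of interfaces $\Gamma_j$; each $\Gamma_j$ is one side of (a part of) a subdomain $\Omega_{l(j)}$ and belongs to the boundary of a subdomain $\Omega_{u(j)}$ with $d_{u(j)}=d_{l(j)}+1$. The medium is connected. Its boundary is split into a Neumann part and a Dirichlet part, the latter containing a face of an $n$-dimensional subdomain. Each $\Omega_i$ has a simplicial mesh (elements $T$, faces $f$), conforming except possibly across fractures and resolving the interfaces and the boundary parts; each $\Gamma_j$ has a simplicial mortar mesh, which need not match the others. The meshes of the subdomains have shape-regularity constant $\sigma$: every element $T$ contains a ball of some radius $\rho_T>0$ with $\operatorname{diam}T\le\sigma\rho_T$. The permeability $K$ is a symmetric positive definite tensor, constant on each subdomain; the normal permeability $K_\nu>0$ and the aperture $\gamma>0$ are constant on each interface. Say that $K$ has anisotropy at most $\kappa$ if on each subdomain $\lambda_{\max}(K)\le\kappa\,\lambda_{\min}(K)$ ($\kappa=1$: isotropic $K$). Let $V_{h}$ be the lowest-order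 Raviart–Thomas space on all subdomains of dimension $\ge1$, with zero normal component on the Neumann boundary, $V_{0h}\subset V_h$ the fluxes with zero normal component on the interfaces, $\Lambda_h$ the piecewise constants on the mortar meshes, $Q_h$ the piecewise constants on the meshes of the subdomains, and $W_h=V_{0h}\times\Lambda_h$. Let $R_h:\Lambda_h\to V_h$ be the extension whose normal component on each face lying on an interface is the mean value of $\lambda$ over that face (the $L^2$ projection to face-wise constants), and is zero on all other faces. Let $[\![\mu]\!]|_{\Omega_i}=-\sum_{l(j)=i}\mu|_{\Gamma_j}$. For $w=(u_0,\lambda)$, $r=(v_0,\mu)\in W_h$, $p\in Q_h$ and $u=u_0+R_h\lambda$, $v=v_0+R_h\mu$ put $$a(w,r)=(K^{-1}u,v)_\Omega+(\gamma K_\nu^{-1}\lambda,\mu)_\Gamma,\qquad b(r,p)=-(p,\nabla\cdot v+[\![\mu]\!])_\Omega,$$ $$a^D(w,r)=\sum_{T}\sum_{f\subset\partial T}(u\cdot\nu_f)(v\cdot\nu_f)(K^{-1}\phi_f,\phi_f)_T+(\gamma K_\nu^{-1}\lambda,\mu)_\Gamma ,$$ where $\phi_f$ is the Raviart–Thomas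 basis function on $T$ with outward normal component $1$ on $f$ and $0$ on the other faces of $T$. Let $A,D_A:W_h\to W_h'$ and $B:W_h\to Q_h'$ be the operators of $a$, $a^D$, $b$, let $S=BD_A^{-1}B^T$, and $$\mathcal A=\begin{pmatrix}A&B^T\\-B&0\end{pmatrix},\qquad \mathcal B_D=\begin{pmatrix}A&0\\0&S\end{pmatrix}^{-1},\qquad \mathcal B_U=\begin{pmatrix}A&B^T\\0&S\end{pmatrix}^{-1},$$ $(x',y')_{\mathcal B_D}=\langle x',\mathcal B_Dy'\rangle$ and $\|x'\|_{\mathcal B_D}^2=(x',x')_{\mathcal B_D}$ on $W_h'\times Q_h'$. **Theorem.** The inverses above exist and $(\cdot,\cdot)_{\mathcal B_D}$ is an inner product. There are a constant $\xi_1>0$, depending only on $n$ and $\sigma$, and for each $\kappa$ a constant $\xi_2>0$, depending only on $n$, $\sigma$ and $\kappa$, such that for all media and meshes with shape-regularity constant $\sigma$, all $K$ of anisotropy at most $\kappa$, all $K_\nu,\gamma$, and all $x'=\mathcal B_U^{-1}x$ with $x=(w_h,p_h)\in W_h\times Q_h$, $x\ne0$, $$\xi_1\le\frac{(\mathcal A\mathcal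 B_Ux',x')_{\mathcal B_D}}{(x',x')_{\mathcal B_D}}\qquad\text{and}\qquad\frac{\|\mathcal A\mathcal B_Ux'\|_{\mathcal B_D}}{\|x'\|_{\mathcal B_D}}\le\xi_2 .$$ In particular, for isotropic $K$ the constants depend neither on the mesh sizes nor on $K$, $K_\nu$, $\gamma$, but only on $n$ and $\sigma$. -/

import Mathlib

open scoped Matrix
open MeasureTheory

noncomputable section

namespace MixedDim

/-- `d`-dimensional Euclidean space. -/
abbrev Eu (d : ℕ) : Type := EuclideanSpace ℝ (Fin d)

/-- The convex hull (closed simplex) of a simplex. -/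
def hull {d : ℕ} (s : Affine.Simplex ℝ (Eu d) d) : Set (Eu d) :=
  convexHull ℝ (Set.range s.points)

/-- Height of the simplex over the face opposite to the vertex `k`. -/
def height {d : ℕ} (s : Affine.Simplex ℝ (Eu d) d) (k : Fin (d + 1)) : ℝ :=
  Metric.infDist (s.points k) (affineSpan ℝ (s.points '' {k}ᶜ) : Set (Eu d))

/-- Lowest-order Raviart-Thomas basis function of the face opposite to the vertex `k`:
its outward normal component is `1` on that face and `0` on all other faces.  The functions
`x ↦ a + b • x` on the simplex are exactly the linear combinations of these `d + 1` functions,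
the coefficients being the (constant) outward normal components on the faces. -/
def rtBasis {d : ℕ} (s : Affine.Simplex ℝ (Eu d) d) (k : Fin (d + 1)) (x : Eu d) : Eu d :=
  (height s k)⁻¹ • (x - s.points k)

/-- The divergence of a vector field. -/
def divergence {d : ℕ} (v : Eu d → Eu d) (x : Eu d) : ℝ :=
  LinearMap.trace ℝ (Eu d) (fderiv ℝ v x).toLinearMap

/-- The data of a mixed-dimensional fractured medium in `ℝⁿ` with simplicial meshes and mortar
meshes.  A subdomain `i` of dimension `d = dim i` is flat, and `chart i` are Cartesian coordinates
on the `d`-dimensional affine subspace containing it.  -/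
structure Grid (n : ℕ) where
  /-- the subdomains of all dimensions (rock, fractures, intersections of fractures, ...) -/
  Sub : Type
  dim : Sub → ℕ
  chart : ∀ i, Eu (dim i) →ᵃⁱ[ℝ] Eu n
  /-- the interfaces: each one is one side of a (part of a) subdomain `lower j`, and belongs to the
  boundary of the subdomain `upper j`, whose dimension is one higher -/
  Ifc : Type
  lower : Ifc → Sub
  upper : Ifc → Sub
  /-- the elements of the subdomain meshes, in the coordinates of their subdomain -/
  Cell : Type
  [fintypeCell : Fintype Cell]
  sub : Cell → Sub
  simplex : ∀ T : Cell, Affine.Simplex ℝ (Eu (dim (sub T))) (dim (sub T))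
  /-- the elements of the mortar meshes, in the coordinates of the lower subdomain -/
  Mortar : Type
  [fintypeMortar : Fintype Mortar]
  ifc : Mortar → Ifc
  mortarSimplex : ∀ m : Mortar,
    Affine.Simplex ℝ (Eu (dim (lower (ifc m)))) (dim (lower (ifc m)))
  /-- the interface which the face opposite to the vertex `k` of the element `T` lies on, if any -/
  faceIfc : (Σ T : Cell, Fin (dim (sub T) + 1)) → Option Ifc
  /-- the element faces on the Neumann (no flow) part of the boundary -/
  neumann : Set (Σ T : Cell, Fin (dim (sub T) + 1))

namespace Grid

variable {n : ℕ} (M : Grid n)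

instance : Fintype M.Cell := M.fintypeCell
instance : Fintype M.Mortar := M.fintypeMortar

/-- The faces of the elements; `⟨T, k⟩` is the face of `T` opposite to the vertex `k`. A face shared
by two elements appears twice, once from either side. -/
abbrev Face : Type := Σ T : M.Cell, Fin (M.dim (M.sub T) + 1)

/-- Dimension of an element. -/
def cdim (T : M.Cell) : ℕ := M.dim (M.sub T)

/-- Closed element, as a subset of `ℝⁿ`. -/
def closedCell (T : M.Cell) : Set (Eu n) := M.chart (M.sub T) '' hull (M.simplex T)

/-- Relatively open element, as a subset of `ℝⁿ`. -/
def openCell (T : M.Cell) : Set (Eu n) := M.chart (M.sub T) '' interior (hull (M.simplex T))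

/-- The vertices of an element, as points of `ℝⁿ`. -/
def verts (T : M.Cell) : Set (Eu n) := M.chart (M.sub T) '' Set.range (M.simplex T).points

/-- The vertices of a face, as points of `ℝⁿ`. -/
def faceVerts (f : M.Face) : Set (Eu n) :=
  M.chart (M.sub f.1) '' ((M.simplex f.1).points '' {f.2}ᶜ)

/-- Closed face, as a subset of `ℝⁿ`. -/
def faceSet (f : M.Face) : Set (Eu n) := convexHull ℝ (M.faceVerts f)

/-- The union of all (closed) subdomains whose dimension is one less than `d`. -/
def below (d : ℕ) : Set (Eu n) := ⋃ (C : M.Cell) (_ : M.cdim C + 1 = d), M.closedCell C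

/-- The set `Γⱼ`, in the coordinates of the lower subdomain. -/
def ifcSet (j : M.Ifc) : Set (Eu n) :=
  ⋃ (m : M.Mortar) (_ : M.ifc m = j), M.chart (M.lower (M.ifc m)) '' hull (M.mortarSimplex m)

/-- Two faces are glued if they are the same face of two different elements of the same subdomain
and this face does not lie on an interface. -/
def Glued (f g : M.Face) : Prop :=
  f.1 ≠ g.1 ∧ M.sub f.1 = M.sub g.1 ∧ M.faceVerts f = M.faceVerts g ∧
    M.faceIfc f = none ∧ M.faceIfc g = none

/-- A boundary face: neither interior to its subdomain nor on an interface. -/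
def IsBoundary (f : M.Face) : Prop :=
  0 < M.cdim f.1 ∧ M.faceIfc f = none ∧ ∀ g, ¬ M.Glued f g

/-- The conditions which make the data a triangulated mixed-dimensional domain. -/
structure IsAdmissible : Prop where
  dim_upper : ∀ j, M.dim (M.upper j) = M.dim (M.lower j) + 1
  /-- elements (of any dimension) do not overlap; in particular the elements of a mesh do not cross
  the subdomains of lower dimension -/
  disjoint_cells : ∀ S T : M.Cell, S ≠ T → Disjoint (M.openCell S) (M.openCell T)
  /-- the mesh of a subdomain is conforming, except possibly across a fracture -/
  conforming : ∀ S T : M.Cell, S ≠ T → M.sub S = M.sub T →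
    M.closedCell S ∩ M.closedCell T = convexHull ℝ (M.verts S ∩ M.verts T) ∨
      M.closedCell S ∩ M.closedCell T ⊆ M.below (M.cdim S)
  /-- each subdomain is connected -/
  connected_sub : ∀ S T : M.Cell, M.sub S = M.sub T →
    Relation.ReflTransGen (fun S' T' => ∃ f g : M.Face, f.1 = S' ∧ g.1 = T' ∧ M.Glued f g) S T
  /-- the whole medium is connected -/
  connected : ∀ i i' : M.Sub,
    Relation.EqvGen (fun a c => ∃ j, M.lower j = a ∧ M.upper j = c) i i'
  /-- the faces on an interface are faces of elements of the upper subdomain -/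
  faceIfc_upper : ∀ f j, M.faceIfc f = some j → M.sub f.1 = M.upper j
  /-- the faces on interfaces are those contained in subdomains of the next lower dimension -/
  faceIfc_isSome : ∀ f, 0 < M.cdim f.1 → M.faceSet f ⊆ M.below (M.cdim f.1) →
    M.faceIfc f ≠ none
  /-- the interface is a part of the lower subdomain ... -/
  ifcSet_lower : ∀ j, M.ifcSet j ⊆ ⋃ (C : M.Cell) (_ : M.sub C = M.lower j), M.closedCell C
  /-- ... triangulated by the faces of the elements of the upper subdomain ... -/
  ifcSet_faces : ∀ j, M.ifcSet j = ⋃ (f : M.Face) (_ : M.faceIfc f = some j), M.faceSet f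
  faces_overlap : ∀ j (f g : M.Face), M.faceIfc f = some j → M.faceIfc g = some j → f ≠ g →
    volume (M.chart (M.lower j) ⁻¹' (M.faceSet f ∩ M.faceSet g)) = 0
  /-- ... and also by the elements of the mortar mesh -/
  mortar_nonempty : ∀ j, ∃ m, M.ifc m = j
  disjoint_mortar : ∀ m m' : M.Mortar, m ≠ m' → M.ifc m = M.ifc m' →
    Disjoint (M.chart (M.lower (M.ifc m)) '' interior (hull (M.mortarSimplex m)))
      (M.chart (M.lower (M.ifc m')) '' interior (hull (M.mortarSimplex m')))
  neumann_boundary : ∀ f ∈ M.neumann, M.IsBoundary f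
  /-- the Dirichlet part of the boundary has positive measure -/
  dirichlet : ∃ f : M.Face, M.cdim f.1 = n ∧ M.IsBoundary f ∧ f ∉ M.neumann

/-- Shape regularity of the subdomain meshes: the ratio of the diameter of an element to the radius
of an inscribed ball is at most `σ`. -/
def ShapeRegular (σ : ℝ) : Prop :=
  ∀ T : M.Cell, ∃ c : Eu (M.dim (M.sub T)), ∃ ρ : ℝ, 0 < ρ ∧
    Metric.closedBall c ρ ⊆ hull (M.simplex T) ∧ Metric.diam (hull (M.simplex T)) ≤ σ * ρ

/-- The physical parameters: the permeability tensor, constant on each subdomain, and the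
normal permeability and the aperture, constant on each interface. -/
structure Params where
  K : ∀ i : M.Sub, Matrix (Fin (M.dim i)) (Fin (M.dim i)) ℝ
  K_posDef : ∀ i, (K i).PosDef
  Kν : M.Ifc → ℝ
  Kν_pos : ∀ j, 0 < Kν j
  γ : M.Ifc → ℝ
  γ_pos : ∀ j, 0 < γ j

/-- On each subdomain the largest eigenvalue of the permeability tensor is at most `κ` times the
smallest one (`κ = 1`: isotropic permeability). -/
def Params.AnisotropyLE {M : Grid n} (P : M.Params) (κ : ℝ) : Prop :=
  ∀ (i : M.Sub) (u v : Eu (M.dim i)),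
    inner ℝ (Matrix.toEuclideanLin (P.K i) u) u * ‖v‖ ^ 2 ≤
      κ * inner ℝ (Matrix.toEuclideanLin (P.K i) v) v * ‖u‖ ^ 2

/-! The discrete spaces -/

/-- The Raviart-Thomas space on all subdomains (zero in dimension `0`).  An element is given by its
outward normal components on the faces of all elements; these are opposite on glued faces, and zero
on the Neumann boundary. -/
def fluxSpace : Submodule ℝ (M.Face → ℝ) where
  carrier := {c | (∀ f g, M.Glued f g → c f + c g = 0) ∧ (∀ f ∈ M.neumann, c f = 0) ∧
    ∀ f, M.cdim f.1 = 0 → c f = 0}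
  add_mem' := by
    rintro a c ⟨h1, h2, h3⟩ ⟨k1, k2, k3⟩
    refine ⟨fun f g h => ?_, fun f h => ?_, fun f h => ?_⟩
    · have := h1 f g h
      have := k1 f g h
      simp only [Pi.add_apply]
      linarith
    · simp [h2 f h, k2 f h]
    · simp [h3 f h, k3 f h]
  zero_mem' := by simp
  smul_mem' := by
    rintro r c ⟨h1, h2, h3⟩
    refine ⟨fun f g h => ?_, fun f h => ?_, fun f h => ?_⟩
    · simp only [Pi.smul_apply, smul_eq_mul, ← mul_add, h1 f g h, mul_zero]
    · simp [h2 f h]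
    · simp [h3 f h]

/-- The fluxes with zero normal component on the interfaces. -/
def fluxSpace₀ : Submodule ℝ (M.Face → ℝ) :=
  M.fluxSpace ⊓
    { carrier := {c | ∀ f, M.faceIfc f ≠ none → c f = 0}
      add_mem' := fun h k f hf => by simp [h f hf, k f hf]
      zero_mem' := by simp
      smul_mem' := fun r c h f hf => by simp [h f hf] }

/-- Piecewise constant mortar functions. -/
abbrev MortarSpace : Type := M.Mortar → ℝ

/-- The space of all flux variables. -/
abbrev W : Type := M.fluxSpace₀ × M.MortarSpace

/-- Piecewise constant pressures. -/
abbrev Q : Type := M.Cell → ℝ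

/-- The vector field on the element `T` with the given outward normal components. -/
def field (T : M.Cell) (c : M.Face → ℝ) (x : Eu (M.dim (M.sub T))) : Eu (M.dim (M.sub T)) :=
  ∑ k, c ⟨T, k⟩ • rtBasis (M.simplex T) k x

open Classical in
/-- The `L²` projection of a mortar function on the interface `j` to the normal traces of the upper
fluxes, which are the functions that are constant on each face: its value on the face `f` is
the mean value over `f`. -/
def proj (j : M.Ifc) (f : M.Face) (μ : M.MortarSpace) : ℝ :=
  (∑ m : M.Mortar with M.ifc m = j,
    μ m * volume.real (hull (M.mortarSimplex m) ∩ M.chart (M.lower (M.ifc m)) ⁻¹' M.faceSet f)) /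
    volume.real (M.chart (M.lower j) ⁻¹' M.faceSet f)

/-- The discrete extension operator: the flux with the projected normal component on the
interfaces, and with zero normal component on all other faces. -/
def ext : M.MortarSpace →ₗ[ℝ] (M.Face → ℝ) where
  toFun μ f := (M.faceIfc f).elim 0 fun j => M.proj j f μ
  map_add' μ μ' := by
    funext f
    rcases h : M.faceIfc f with _ | j
    · simp [h]
    · simp [h, proj, add_mul, Finset.sum_add_distrib, add_div]
  map_smul' r μ := by
    funext f
    rcases h : M.faceIfc f with _ | j
    · simp [h]
    · simp [h, proj, mul_assoc, ← Finset.mul_sum, mul_div_assoc]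

/-- The total flux `u₀ + R λ`. -/
def totalFlux : M.W →ₗ[ℝ] (M.Face → ℝ) :=
  M.fluxSpace₀.subtype ∘ₗ LinearMap.fst ℝ _ _ + M.ext ∘ₗ LinearMap.snd ℝ _ _

variable {M}

theorem field_add (T : M.Cell) (c c' : M.Face → ℝ) (x : Eu (M.dim (M.sub T))) :
    M.field T (c + c') x = M.field T c x + M.field T c' x := by
  simp [field, add_smul, Finset.sum_add_distrib]

theorem field_smul (T : M.Cell) (r : ℝ) (c : M.Face → ℝ) (x : Eu (M.dim (M.sub T))) :
    M.field T (r • c) x = r • M.field T c x := by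
  simp [field, mul_smul, Finset.smul_sum]

theorem field_contDiff (T : M.Cell) (c : M.Face → ℝ) : ContDiff ℝ 1 (M.field T c) := by
  unfold field rtBasis
  fun_prop

theorem isCompact_hull {d : ℕ} (s : Affine.Simplex ℝ (Eu d) d) : IsCompact (hull s) :=
  (Set.finite_range s.points).isCompact_convexHull ℝ

namespace Params

/-- The inverse of the permeability tensor. -/
def invK (P : M.Params) (i : M.Sub) : Eu (M.dim i) →ₗ[ℝ] Eu (M.dim i) :=
  Matrix.toEuclideanLin (P.K i)⁻¹

theorem integrableOn_inner (P : M.Params) (T : M.Cell) (c c' : M.Face → ℝ) :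
    IntegrableOn (fun x => inner ℝ (P.invK (M.sub T) (M.field T c x)) (M.field T c' x))
      (hull (M.simplex T)) volume := by
  apply ContinuousOn.integrableOn_compact (isCompact_hull _)
  apply Continuous.continuousOn
  exact Continuous.inner (𝕜 := ℝ)
    ((LinearMap.continuous_of_finiteDimensional (P.invK (M.sub T))).comp
      (field_contDiff T c).continuous)
    (field_contDiff T c').continuous

/-- `(K⁻¹ u, v)_Ω`. -/
def mass (P : M.Params) : (M.Face → ℝ) →ₗ[ℝ] (M.Face → ℝ) →ₗ[ℝ] ℝ :=
  LinearMap.mk₂ ℝ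
    (fun c c' => ∑ T, ∫ x in hull (M.simplex T),
      inner ℝ (P.invK (M.sub T) (M.field T c x)) (M.field T c' x))
    (fun c₁ c₂ c' => by
      simp only [field_add, map_add, inner_add_left, ← Finset.sum_add_distrib]
      refine Finset.sum_congr rfl fun T _ => ?_
      exact integral_add (P.integrableOn_inner T c₁ c') (P.integrableOn_inner T c₂ c'))
    (fun r c c' => by
      simp only [field_smul, map_smul, real_inner_smul_left, Finset.mul_sum, smul_eq_mul]
      exact Finset.sum_congr rfl fun _ _ => integral_const_mul (L := ℝ) _ _)
    (fun c c₁ c₂ => by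
      simp only [field_add, inner_add_right, ← Finset.sum_add_distrib]
      refine Finset.sum_congr rfl fun T _ => ?_
      exact integral_add (P.integrableOn_inner T c c₁) (P.integrableOn_inner T c c₂))
    (fun r c c' => by
      simp only [field_smul, real_inner_smul_right, Finset.mul_sum, smul_eq_mul]
      exact Finset.sum_congr rfl fun _ _ => integral_const_mul (L := ℝ) _ _)

/-- `(K⁻¹ u, v)_{D,Ω}`: the element matrices of `(K⁻¹ u, v)_Ω` are replaced by their diagonals. -/
def massD (P : M.Params) : (M.Face → ℝ) →ₗ[ℝ] (M.Face → ℝ) →ₗ[ℝ] ℝ :=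
  LinearMap.mk₂ ℝ
    (fun c c' => ∑ T, ∑ k, c ⟨T, k⟩ * c' ⟨T, k⟩ * ∫ x in hull (M.simplex T),
      inner ℝ (P.invK (M.sub T) (rtBasis (M.simplex T) k x)) (rtBasis (M.simplex T) k x))
    (fun c₁ c₂ c' => by simp [add_mul, Finset.sum_add_distrib])
    (fun r c c' => by simp [Finset.mul_sum, mul_assoc])
    (fun c c₁ c₂ => by simp [mul_add, add_mul, Finset.sum_add_distrib])
    (fun r c c' => by simp [Finset.mul_sum, mul_assoc, mul_left_comm])

/-- `(γ Kν⁻¹ λ, μ)_Γ`. -/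
def mortarMass (P : M.Params) : M.MortarSpace →ₗ[ℝ] M.MortarSpace →ₗ[ℝ] ℝ :=
  LinearMap.mk₂ ℝ
    (fun l μ => ∑ m, P.γ (M.ifc m) * (P.Kν (M.ifc m))⁻¹ * (l m * μ m) *
      volume.real (hull (M.mortarSimplex m)))
    (fun l l' μ => by simp [mul_add, add_mul, Finset.sum_add_distrib])
    (fun r l μ => by
      simp only [Pi.smul_apply, smul_eq_mul, Finset.mul_sum]
      exact Finset.sum_congr rfl fun _ _ => by ring)
    (fun l μ μ' => by simp [mul_add, add_mul, Finset.sum_add_distrib])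
    (fun r l μ => by
      simp only [Pi.smul_apply, smul_eq_mul, Finset.mul_sum]
      exact Finset.sum_congr rfl fun _ _ => by ring)

/-- The operator `A`, `⟨A w, r⟩ = a(w, r) = (K⁻¹(u₀ + Rλ), v₀ + Rμ)_Ω + (γ Kν⁻¹ λ, μ)_Γ`. -/
def opA (P : M.Params) : M.W →ₗ[ℝ] Module.Dual ℝ M.W :=
  P.mass.compl₁₂ M.totalFlux M.totalFlux +
    P.mortarMass.compl₁₂ (LinearMap.snd ℝ _ _) (LinearMap.snd ℝ _ _)

/-- The operator `D_A`, `⟨D_A w, r⟩ = (K⁻¹(u₀ + Rλ), v₀ + Rμ)_{D,Ω} + (γ Kν⁻¹ λ, μ)_Γ`. -/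
def opDA (P : M.Params) : M.W →ₗ[ℝ] Module.Dual ℝ M.W :=
  P.massD.compl₁₂ M.totalFlux M.totalFlux +
    P.mortarMass.compl₁₂ (LinearMap.snd ℝ _ _) (LinearMap.snd ℝ _ _)

end Params

theorem divergence_field_add (T : M.Cell) (c c' : M.Face → ℝ) (x : Eu (M.dim (M.sub T))) :
    divergence (M.field T (c + c')) x =
      divergence (M.field T c) x + divergence (M.field T c') x := by
  have h : M.field T (c + c') = M.field T c + M.field T c' := funext (field_add T c c')
  have hc := (field_contDiff T c).differentiable one_ne_zero x
  have hc' := (field_contDiff T c').differentiable one_ne_zero x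
  simp [divergence, h, fderiv_add hc hc']

theorem divergence_field_smul (T : M.Cell) (r : ℝ) (c : M.Face → ℝ)
    (x : Eu (M.dim (M.sub T))) :
    divergence (M.field T (r • c)) x = r * divergence (M.field T c) x := by
  have h : M.field T (r • c) = r • M.field T c := funext (field_smul T r c)
  have hc := (field_contDiff T c).differentiable one_ne_zero x
  simp [divergence, h, fderiv_const_smul hc]

theorem integrableOn_divergence (T : M.Cell) (c : M.Face → ℝ) :
    IntegrableOn (fun x => divergence (M.field T c) x) (hull (M.simplex T)) volume := by
  apply ContinuousOn.integrableOn_compact (isCompact_hull _)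
  apply Continuous.continuousOn
  have h : Continuous (fun x => fderiv ℝ (M.field T c) x) :=
    (field_contDiff T c).continuous_fderiv one_ne_zero
  let L : (Eu (M.dim (M.sub T)) →L[ℝ] Eu (M.dim (M.sub T))) →ₗ[ℝ] ℝ :=
    LinearMap.trace ℝ _ ∘ₗ ContinuousLinearMap.coeLM ℝ
  exact (LinearMap.continuous_of_finiteDimensional L).comp h

variable (M)

/-- `(∇ · v, p)_Ω`. -/
def divForm : (M.Face → ℝ) →ₗ[ℝ] M.Q →ₗ[ℝ] ℝ :=
  LinearMap.mk₂ ℝ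
    (fun c p => ∑ T, ∫ x in hull (M.simplex T), p T * divergence (M.field T c) x)
    (fun c c' p => by
      simp only [integral_const_mul, divergence_field_add, ← Finset.sum_add_distrib, ← mul_add]
      refine Finset.sum_congr rfl fun T _ => ?_
      rw [integral_add (integrableOn_divergence T c) (integrableOn_divergence T c')])
    (fun r c p => by
      simp only [divergence_field_smul, integral_const_mul, Finset.mul_sum, smul_eq_mul]
      exact Finset.sum_congr rfl fun _ _ => by ring)
    (fun c p p' => by
      simp only [integral_const_mul, Pi.add_apply]
      simp only [add_mul, Finset.sum_add_distrib])
    (fun r c p => by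
      simp only [integral_const_mul, Pi.smul_apply, smul_eq_mul, Finset.mul_sum, mul_assoc])

open Classical in
/-- `(⟦μ⟧, p)_Ω`, where the jump `⟦μ⟧` on a subdomain is minus the sum of the mortar functions
on the interfaces of this subdomain. -/
def jumpForm : M.MortarSpace →ₗ[ℝ] M.Q →ₗ[ℝ] ℝ :=
  LinearMap.mk₂ ℝ
    (fun μ p => -∑ m, ∑ C : M.Cell with M.sub C = M.lower (M.ifc m), μ m * p C *
      volume.real (hull (M.mortarSimplex m) ∩
        M.chart (M.lower (M.ifc m)) ⁻¹' M.closedCell C))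
    (fun μ μ' p => by
      simp only [Pi.add_apply, add_mul, Finset.sum_add_distrib, neg_add])
    (fun r μ p => by
      simp only [Pi.smul_apply, smul_eq_mul, mul_neg, Finset.mul_sum, mul_assoc])
    (fun μ p p' => by
      simp only [Pi.add_apply, mul_add, add_mul, Finset.sum_add_distrib, neg_add])
    (fun r μ p => by
      simp only [Pi.smul_apply, smul_eq_mul, mul_neg, Finset.mul_sum, mul_assoc,
        mul_left_comm _ r])

/-- The operator `B`, `⟨B r, p⟩ = b(r, p) = -(p, ∇ · (v₀ + Rμ) + ⟦μ⟧)_Ω`. -/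
def opB : M.W →ₗ[ℝ] Module.Dual ℝ M.Q :=
  -(M.divForm.compl₁₂ M.totalFlux LinearMap.id +
    M.jumpForm.compl₁₂ (LinearMap.snd ℝ _ _) LinearMap.id)

end Grid

/-! Block operators -/

open Classical in
/-- The inverse of a bijective linear map. -/
def linInv {X Y : Type*} [AddCommGroup X] [Module ℝ X] [AddCommGroup Y] [Module ℝ Y]
    (T : X →ₗ[ℝ] Y) : Y →ₗ[ℝ] X :=
  if h : Function.Bijective T then (LinearEquiv.ofBijective T h).symm.toLinearMap else 0

section Block

variable {W Q : Type*} [AddCommGroup W] [Module ℝ W] [AddCommGroup Q] [Module ℝ Q]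

/-- The operator with the block matrix `(E F; G H)`. -/
def block (E : W →ₗ[ℝ] Module.Dual ℝ W) (F : Q →ₗ[ℝ] Module.Dual ℝ W)
    (G : W →ₗ[ℝ] Module.Dual ℝ Q) (H : Q →ₗ[ℝ] Module.Dual ℝ Q) :
    W × Q →ₗ[ℝ] Module.Dual ℝ W × Module.Dual ℝ Q :=
  (E.coprod F).prod (G.coprod H)

/-- The duality pairing. -/
def pairing (x' : Module.Dual ℝ W × Module.Dual ℝ Q) (x : W × Q) : ℝ := x'.1 x.1 + x'.2 x.2

/-- `(x', y')_𝓜 = ⟨x', 𝓜 y'⟩`. -/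
def dualInner (M : Module.Dual ℝ W × Module.Dual ℝ Q →ₗ[ℝ] W × Q)
    (x' y' : Module.Dual ℝ W × Module.Dual ℝ Q) : ℝ := pairing x' (M y')

/-- `‖x'‖_𝓜`. -/
def dualNorm (M : Module.Dual ℝ W × Module.Dual ℝ Q →ₗ[ℝ] W × Q)
    (x' : Module.Dual ℝ W × Module.Dual ℝ Q) : ℝ := √(dualInner M x' x')

end Block

namespace Grid.Params

variable {n : ℕ} {M : Grid n} (P : M.Params)

/-- `B D_A⁻¹ Bᵀ`. -/
def schur : M.Q →ₗ[ℝ] Module.Dual ℝ M.Q := M.opB ∘ₗ linInv P.opDA ∘ₗ M.opB.flip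

/-- The operator `𝓐 = (A Bᵀ; -B 0)` of the discrete problem. -/
def calA : M.W × M.Q →ₗ[ℝ] Module.Dual ℝ M.W × Module.Dual ℝ M.Q :=
  block P.opA M.opB.flip (-M.opB) 0

/-- The block diagonal operator `(A 0; 0 B D_A⁻¹ Bᵀ)`. -/
def blockD : M.W × M.Q →ₗ[ℝ] Module.Dual ℝ M.W × Module.Dual ℝ M.Q :=
  block P.opA 0 0 P.schur

/-- The block upper triangular operator `(A Bᵀ; 0 B D_A⁻¹ Bᵀ)`. -/
def blockU : M.W × M.Q →ₗ[ℝ] Module.Dual ℝ M.W × Module.Dual ℝ M.Q :=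
  block P.opA M.opB.flip 0 P.schur

/-- The block diagonal preconditioner. -/
def calBD : Module.Dual ℝ M.W × Module.Dual ℝ M.Q →ₗ[ℝ] M.W × M.Q := linInv P.blockD

/-- The block upper triangular preconditioner. -/
def calBU : Module.Dual ℝ M.W × Module.Dual ℝ M.Q →ₗ[ℝ] M.W × M.Q := linInv P.blockU

end Grid.Params

end MixedDim

end

/-!
An element `T` of dimension `d ≤ n` has at most `d + 1 ≤ n + 1` faces, so Cauchy–Schwarz gives
`A ≤ (n + 1) D_A`. Conversely, a Raviart–Thomas function has on `T` the form `a + t (x - x₀)`, and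
somewhere in the ball inscribed in `T` there is a smaller ball on which its modulus is bounded below
by each of its normal components; hence `D_A ≤ c A`, with `c` depending only on `n`, `σ` and `κ`.

The Schur complement `S = B D_A⁻¹ Bᵀ` is built from `D_A` itself, so no inf-sup constant enters:
all that is needed is that `Bᵀ` is injective. A pressure in its kernel takes the same value on
elements sharing a face and on subdomains joined by an interface, hence is constant by connectedness
of the medium, and it vanishes next to a Dirichlet face.

The rest is linear algebra. For `x = (w, p)` write `Bᵀ p = A z` and `S q = -B w`. In these terms
`x' = ℬ_U⁻¹ x` and `𝒜 x` are the images under the block diagonal operator of `(w + z, p)` and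
`(w + z, q)`, so that both bounds become statements about `A`-norms and `S`-norms, in which
`w`, `z` and `q` are compared through the equivalence of `A` and `D_A`.
-/

noncomputable section

namespace MixedDim

section SPD

variable {W : Type*} [AddCommGroup W] [Module ℝ W]

/-- A symmetric positive definite operator from a real vector space to its dual, that is, an inner
product presented as an operator. -/
structure IsSPD (A : W →ₗ[ℝ] Module.Dual ℝ W) : Prop where
  symm : ∀ x y, A x y = A y x
  pos : ∀ x, x ≠ 0 → 0 < A x x

namespace IsSPD

variable {A : W →ₗ[ℝ] Module.Dual ℝ W}

theorem nonneg (hA : IsSPD A) (x : W) : 0 ≤ A x x := by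
  rcases eq_or_ne x 0 with rfl | hx
  · simp
  · exact (hA.pos x hx).le

theorem bijective [FiniteDimensional ℝ W] (hA : IsSPD A) : Function.Bijective A := by
  have hinj : Function.Injective A := by
    rw [injective_iff_map_eq_zero]
    intro x hx
    by_contra hne
    exact (hA.pos x hne).ne' (by simp [hx])
  exact ⟨hinj, (LinearMap.injective_iff_surjective_of_finrank_eq_finrank
    Subspace.dual_finrank_eq.symm).1 hinj⟩

theorem apply_add_self (hA : IsSPD A) (x y : W) :
    A (x + y) (x + y) = A x x + 2 * A y x + A y y := by
  simp only [map_add, LinearMap.add_apply, hA.symm x y]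
  ring

theorem apply_sub_self (hA : IsSPD A) (x y : W) :
    A (x - y) (x - y) = A x x - 2 * A y x + A y y := by
  simp only [map_sub, LinearMap.sub_apply, hA.symm x y]
  ring

theorem apply_self_le_two_mul_add (hA : IsSPD A) (x y : W) :
    A x x ≤ 2 * (A (x + y) (x + y) + A y y) := by
  have hnonneg := hA.nonneg (x + y + y)
  rw [hA.apply_add_self, hA.apply_add_self, map_add] at hnonneg
  rw [hA.apply_add_self]
  linarith

/-- This is `D⁻¹ ≤ c A⁻¹`, evaluated at the functional `D y = A z`. -/
theorem dual_le (hA : IsSPD A) {D : W →ₗ[ℝ] Module.Dual ℝ W} {c : ℝ} (hc : 0 < c)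
    (hAD : ∀ w, A w w ≤ c * D w w) {y z : W} (hyz : D y = A z) : D y y ≤ c * A z z := by
  have hzy : A z y = D y y := by rw [hyz]
  have hnonneg := hA.nonneg (y - c • z)
  rw [hA.apply_sub_self] at hnonneg
  simp only [map_smul, LinearMap.smul_apply, smul_eq_mul, hzy] at hnonneg
  have hy := hAD y
  refine le_of_mul_le_mul_left ?_ hc
  linarith

end IsSPD

end SPD

section BlockPreconditioner

variable {W Q : Type*} [AddCommGroup W] [Module ℝ W] [AddCommGroup Q] [Module ℝ Q]

theorem linInv_apply {T : W →ₗ[ℝ] Q} (hT : Function.Bijective T) (x : W) :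
    linInv T (T x) = x := by
  rw [linInv, dif_pos hT]
  exact LinearEquiv.ofBijective_symm_apply_apply T x

theorem apply_linInv {T : W →ₗ[ℝ] Q} (hT : Function.Bijective T) (y : Q) :
    T (linInv T y) = y := by
  obtain ⟨x, rfl⟩ := hT.2 y
  rw [linInv_apply hT]

theorem dualInner_linInv_apply {T : W × Q →ₗ[ℝ] Module.Dual ℝ W × Module.Dual ℝ Q}
    (hT : Function.Bijective T) (x' : Module.Dual ℝ W × Module.Dual ℝ Q) (x : W × Q) :
    dualInner (linInv T) x' (T x) = pairing x' x := by
  rw [dualInner, linInv_apply hT]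

theorem pairing_block_diag (A : W →ₗ[ℝ] Module.Dual ℝ W) (S : Q →ₗ[ℝ] Module.Dual ℝ Q)
    (x y : W × Q) : pairing (block A 0 0 S x) y = A x.1 y.1 + S x.2 y.2 := by
  simp [pairing, block]

theorem block_upper_apply {A : W →ₗ[ℝ] Module.Dual ℝ W} {F : Q →ₗ[ℝ] Module.Dual ℝ W}
    (S : Q →ₗ[ℝ] Module.Dual ℝ Q) (w : W) {z : W} {p : Q} (hz : A z = F p) :
    block A F 0 S (w, p) = block A 0 0 S (w + z, p) := by
  simp [block, hz]

theorem block_saddle_apply {A : W →ₗ[ℝ] Module.Dual ℝ W} {F : Q →ₗ[ℝ] Module.Dual ℝ W}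
    {B : W →ₗ[ℝ] Module.Dual ℝ Q} {S : Q →ₗ[ℝ] Module.Dual ℝ Q} {w z : W} {p q : Q}
    (hz : A z = F p) (hq : S q = -B w) :
    block A F (-B) 0 (w, p) = block A 0 0 S (w + z, q) := by
  simp [block, hz, hq]

/-- The Schur complement `B D⁻¹ Bᵀ`. -/
def schurComplement (B : W →ₗ[ℝ] Module.Dual ℝ Q) (D : W →ₗ[ℝ] Module.Dual ℝ W) :
    Q →ₗ[ℝ] Module.Dual ℝ Q :=
  B ∘ₗ linInv D ∘ₗ B.flip

variable [FiniteDimensional ℝ W]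
variable {A D : W →ₗ[ℝ] Module.Dual ℝ W} {B : W →ₗ[ℝ] Module.Dual ℝ Q}
  {S : Q →ₗ[ℝ] Module.Dual ℝ Q}

theorem schurComplement_apply (hD : IsSPD D) (p q : Q) :
    schurComplement B D p q = D (linInv D (B.flip p)) (linInv D (B.flip q)) := by
  rw [hD.symm, apply_linInv hD.bijective (B.flip q)]
  rfl

theorem IsSPD.schurComplement (hD : IsSPD D) (hB : Function.Injective B.flip) :
    IsSPD (schurComplement B D) := by
  refine ⟨fun p q => ?_, fun p hp => ?_⟩
  · rw [schurComplement_apply hD, schurComplement_apply hD, hD.symm]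
  · rw [schurComplement_apply hD]
    refine hD.pos _ fun h => hp (hB ?_)
    rw [← apply_linInv hD.bijective (B.flip p), h, map_zero, map_zero]

theorem schurComplement_apply_self_le (hD : IsSPD D) {w : W} {q : Q}
    (hq : schurComplement B D q = -B w) : schurComplement B D q q ≤ D w w := by
  set t := linInv D (B.flip q)
  have hSq : schurComplement B D q q = D t t := schurComplement_apply hD q q
  have ht : D t w = -schurComplement B D q q := by
    rw [hq, apply_linInv hD.bijective, LinearMap.neg_apply, neg_neg, LinearMap.flip_apply]
  have hnonneg := hD.nonneg (w + t)
  rw [hD.apply_add_self] at hnonneg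
  linarith

variable [FiniteDimensional ℝ Q]

theorem IsSPD.bijective_block_upper (hA : IsSPD A) (hS : IsSPD S)
    (F : Q →ₗ[ℝ] Module.Dual ℝ W) : Function.Bijective (block A F 0 S) := by
  constructor
  · rw [injective_iff_map_eq_zero]
    rintro ⟨w, p⟩ h
    simp only [block, LinearMap.prod_apply, Function.prod, LinearMap.coprod_apply,
      LinearMap.zero_apply, zero_add, Prod.mk_eq_zero] at h
    obtain rfl : p = 0 := hS.bijective.1 (by rw [h.2, map_zero])
    obtain rfl : w = 0 := hA.bijective.1 (by simpa using h.1)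
    rfl
  · rintro ⟨f, g⟩
    obtain ⟨p, rfl⟩ := hS.bijective.2 g
    obtain ⟨w, hw⟩ := hA.bijective.2 (f - F p)
    exact ⟨(w, p), by simp [block, hw]⟩

theorem IsSPD.dualInner_block_diag (hA : IsSPD A) (hS : IsSPD S) (x y : W × Q) :
    dualInner (linInv (block A 0 0 S)) (block A 0 0 S x) (block A 0 0 S y) =
      A x.1 y.1 + S x.2 y.2 := by
  rw [dualInner_linInv_apply (hA.bijective_block_upper hS 0), pairing_block_diag]

theorem IsSPD.dualInner_block_diag_comm (hA : IsSPD A) (hS : IsSPD S)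
    (x' y' : Module.Dual ℝ W × Module.Dual ℝ Q) :
    dualInner (linInv (block A 0 0 S)) x' y' = dualInner (linInv (block A 0 0 S)) y' x' := by
  have hbij := hA.bijective_block_upper hS 0
  obtain ⟨x, rfl⟩ := hbij.2 x'
  obtain ⟨y, rfl⟩ := hbij.2 y'
  rw [hA.dualInner_block_diag hS, hA.dualInner_block_diag hS, hA.symm, hS.symm]

theorem IsSPD.dualInner_block_diag_pos (hA : IsSPD A) (hS : IsSPD S)
    {x' : Module.Dual ℝ W × Module.Dual ℝ Q} (hx' : x' ≠ 0) :
    0 < dualInner (linInv (block A 0 0 S)) x' x' := by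
  obtain ⟨⟨w, p⟩, rfl⟩ := (hA.bijective_block_upper hS 0).2 x'
  rw [hA.dualInner_block_diag hS]
  rcases eq_or_ne w 0 with rfl | hw
  · refine add_pos_of_nonneg_of_pos (hA.nonneg 0) (hS.pos p fun hp => hx' ?_)
    rw [show p = 0 from hp, Prod.mk_zero_zero, map_zero]
  · exact add_pos_of_pos_of_nonneg (hA.pos w hw) (hS.nonneg p)

theorem le_dualInner_saddle_div (hA : IsSPD A) (hD : IsSPD D) (hB : Function.Injective B.flip)
    {c : ℝ} (hc : 0 < c) (hAD : ∀ w, A w w ≤ c * D w w) {x : W × Q} (hx : x ≠ 0) :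
    (2 * (1 + c))⁻¹ ≤
      dualInner (linInv (block A 0 0 (schurComplement B D))) (block A B.flip (-B) 0 x)
        (block A B.flip 0 (schurComplement B D) x) /
      dualInner (linInv (block A 0 0 (schurComplement B D)))
        (block A B.flip 0 (schurComplement B D) x)
        (block A B.flip 0 (schurComplement B D) x) := by
  have hS := hD.schurComplement hB
  have hU := hA.bijective_block_upper hS B.flip
  have hpos := hA.dualInner_block_diag_pos hS ((map_ne_zero_iff _ hU.1).2 hx)
  obtain ⟨w, p⟩ := x
  obtain ⟨z, hz⟩ := hA.bijective.2 (B.flip p)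
  obtain ⟨q, hq⟩ := hS.bijective.2 (-B w)
  rw [inv_eq_one_div, div_le_div_iff₀ (by positivity) hpos, one_mul]
  rw [block_upper_apply _ w hz, block_saddle_apply hz hq, hA.dualInner_block_diag hS,
    hA.dualInner_block_diag hS]
  have hSqp : schurComplement B D q p = -A z w := by rw [hq, hz]; rfl
  have hSpp : schurComplement B D p p ≤ c * A z z := by
    rw [schurComplement_apply hD]
    exact hA.dual_le hc hAD (by rw [apply_linInv hD.bijective, hz])
  have hwz := hA.nonneg (w + z)
  rw [hA.apply_add_self] at hwz ⊢
  rw [hSqp]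
  have hAzz : A z z ≤ 2 * (A w w + A z w + A z z) := by linarith [hA.nonneg w]
  linarith [hA.nonneg w, hA.nonneg z, mul_le_mul_of_nonneg_left hAzz hc.le]

theorem dualNorm_saddle_div_le (hA : IsSPD A) (hD : IsSPD D) (hB : Function.Injective B.flip)
    {c : ℝ} (hc : 0 < c) (hDA : ∀ w, D w w ≤ c * A w w) {x : W × Q} (hx : x ≠ 0) :
    dualNorm (linInv (block A 0 0 (schurComplement B D))) (block A B.flip (-B) 0 x) /
      dualNorm (linInv (block A 0 0 (schurComplement B D)))
        (block A B.flip 0 (schurComplement B D) x) ≤ 1 + 2 * c := by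
  have hS := hD.schurComplement hB
  have hU := hA.bijective_block_upper hS B.flip
  have hpos := hA.dualInner_block_diag_pos hS ((map_ne_zero_iff _ hU.1).2 hx)
  rw [dualNorm, dualNorm, div_le_iff₀ (Real.sqrt_pos.2 hpos),
    Real.sqrt_le_left (by positivity), mul_pow, Real.sq_sqrt hpos.le]
  obtain ⟨w, p⟩ := x
  obtain ⟨z, hz⟩ := hA.bijective.2 (B.flip p)
  obtain ⟨q, hq⟩ := hS.bijective.2 (-B w)
  rw [block_upper_apply _ w hz, block_saddle_apply hz hq, hA.dualInner_block_diag hS,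
    hA.dualInner_block_diag hS]
  have hSqq := (schurComplement_apply_self_le hD hq).trans (hDA w)
  have hSpp := hS.nonneg p
  have hAzz : A z z ≤ c * schurComplement B D p p := by
    rw [schurComplement_apply hD]
    exact hD.dual_le hc hDA (by rw [apply_linInv hD.bijective, hz])
  have hAww := hA.apply_self_le_two_mul_add w z
  have hAwz := hA.nonneg (w + z)
  calc A (w + z) (w + z) + schurComplement B D q q
      ≤ A (w + z) (w + z) +
          c * (2 * (A (w + z) (w + z) + c * schurComplement B D p p)) := by
        gcongr
        exact hSqq.trans (by gcongr; linarith)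
    _ ≤ (1 + 2 * c) ^ 2 * (A (w + z) (w + z) + schurComplement B D p p) := by
        rw [← sub_nonneg]
        ring_nf
        positivity

end BlockPreconditioner

section Simplex

variable {d : ℕ} (s : Affine.Simplex ℝ (Eu d) d)

/-- The vertices of a simplex of full dimension, as an affine basis: its coordinates are the
barycentric coordinates. -/
def vertexBasis : AffineBasis (Fin (d + 1)) ℝ (Eu d) :=
  ⟨s.points, s.independent, s.span_eq_top finrank_euclideanSpace_fin⟩

theorem vertexBasis_apply (j : Fin (d + 1)) : vertexBasis s j = s.points j := rfl

theorem interior_hull : interior (hull s) = {x | ∀ i, 0 < (vertexBasis s).coord i x} :=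
  (vertexBasis s).interior_convexHull

theorem interior_hull_nonempty : (interior (hull s)).Nonempty := by
  rw [hull, interior_convexHull_nonempty_iff_affineSpan_eq_top]
  exact s.span_eq_top finrank_euclideanSpace_fin

theorem measurableSet_hull : MeasurableSet (hull s) := (Grid.isCompact_hull s).measurableSet

theorem volume_hull_ne_top : volume (hull s) ≠ ⊤ := (Grid.isCompact_hull s).measure_lt_top.ne

theorem volume_real_hull_pos : 0 < volume.real (hull s) := by
  refine ENNReal.toReal_pos (ne_of_gt ?_) (volume_hull_ne_top s)
  exact (isOpen_interior.measure_pos volume (interior_hull_nonempty s)).trans_le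
    (measure_mono interior_subset)

theorem setIntegral_hull_pos {g : Eu d → ℝ} (hg : Continuous g) (hnonneg : ∀ x, 0 ≤ g x)
    {y : Eu d} (hy : y ∈ hull s) (hgy : g y ≠ 0) : 0 < ∫ x in hull s, g x := by
  rw [setIntegral_pos_iff_support_of_nonneg_ae (ae_of_all _ hnonneg)
    (hg.continuousOn.integrableOn_compact (Grid.isCompact_hull s))]
  have hclosure : y ∈ closure (interior (hull s)) := by
    rw [hull, (convex_convexHull ℝ _).closure_interior_eq_closure_of_nonempty_interior
      (interior_hull_nonempty s)]
    exact subset_closure hy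
  have hopen : IsOpen (Function.support g) := isOpen_ne_fun hg continuous_const
  exact ((hopen.inter isOpen_interior).measure_pos volume
    (mem_closure_iff.1 hclosure _ hopen hgy)).trans_le
    (measure_mono (Set.inter_subset_inter_right _ interior_subset))

/-- The closed face opposite to the vertex `k`. -/
def faceHull (k : Fin (d + 1)) : Set (Eu d) := convexHull ℝ (s.points '' {k}ᶜ)

variable [NeZero d]

theorem faceHull_eq_closedInterior (k : Fin (d + 1)) :
    faceHull s k = (s.faceOpposite k).closedInterior := by
  rw [faceHull, ← Affine.Simplex.convexHull_eq_closedInterior,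
    Affine.Simplex.range_faceOpposite_points]

theorem height_eq (k : Fin (d + 1)) : height s k = s.height k := by
  rw [height, Affine.Simplex.height, Affine.Simplex.altitudeFoot,
    Affine.Simplex.orthogonalProjectionSpan, ← Affine.Simplex.range_faceOpposite_points]
  exact (EuclideanGeometry.dist_orthogonalProjection_eq_infDist _ _).symm

theorem height_pos (k : Fin (d + 1)) : 0 < height s k := by
  rw [height_eq]
  exact s.height_pos k

/-- The outward unit normal of the face opposite to the vertex `k`. -/
def unitNormal (k : Fin (d + 1)) : Eu d :=
  (height s k)⁻¹ • (s.altitudeFoot k - s.points k)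

theorem norm_altitudeFoot_sub (k : Fin (d + 1)) :
    ‖s.altitudeFoot k - s.points k‖ = height s k := by
  rw [height_eq, ← dist_eq_norm, dist_comm, Affine.Simplex.height]

theorem norm_unitNormal (k : Fin (d + 1)) : ‖unitNormal s k‖ = 1 := by
  rw [unitNormal, norm_smul, norm_altitudeFoot_sub, norm_inv,
    Real.norm_of_nonneg (height_pos s k).le, inv_mul_cancel₀ (height_pos s k).ne']

theorem inner_unitNormal_sub {j k : Fin (d + 1)} (hj : j ≠ k) :
    inner ℝ (unitNormal s k) (s.points j - s.points k) = height s k := by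
  have hinner := s.inner_vsub_vsub_altitudeFoot_eq_height_sq hj.symm
  rw [vsub_eq_sub, vsub_eq_sub, ← height_eq] at hinner
  rw [unitNormal, real_inner_smul_left, real_inner_comm, ← neg_sub (s.points k),
    ← neg_sub (s.points k), inner_neg_neg, hinner, sq, inv_mul_cancel_left₀ (height_pos s k).ne']

theorem inner_unitNormal_sub_mem_Icc {x : Eu d} (hx : x ∈ hull s) (k : Fin (d + 1)) :
    inner ℝ (unitNormal s k) (x - s.points k) ∈ Set.Icc 0 (height s k) := by
  set a := inner ℝ (unitNormal s k) (s.points k)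
  have hconvex : Convex ℝ (innerₗ (Eu d) (unitNormal s k) ⁻¹' Set.Icc a (a + height s k)) :=
    (convex_Icc _ _).linear_preimage _
  have hpos := height_pos s k
  have hmem : x ∈ innerₗ (Eu d) (unitNormal s k) ⁻¹' Set.Icc a (a + height s k) := by
    refine convexHull_min ?_ hconvex hx
    rintro _ ⟨j, rfl⟩
    rw [Set.mem_preimage, innerₗ_apply_apply]
    rcases eq_or_ne j k with rfl | hj
    · exact ⟨le_rfl, le_add_of_nonneg_right hpos.le⟩
    · have hheight := inner_unitNormal_sub s hj
      rw [inner_sub_right, sub_eq_iff_eq_add'] at hheight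
      rw [hheight]
      exact ⟨le_add_of_nonneg_right hpos.le, le_rfl⟩
  rwa [Set.mem_preimage, innerₗ_apply_apply, Set.mem_Icc, ← sub_nonneg, ← sub_le_iff_le_add',
    ← inner_sub_right] at hmem

theorem two_mul_le_height {c : Eu d} {ρ : ℝ} (hρ : 0 ≤ ρ)
    (hball : Metric.closedBall c ρ ⊆ hull s) (k : Fin (d + 1)) : 2 * ρ ≤ height s k := by
  have hmem : ∀ r : ℝ, |r| ≤ ρ → c + r • unitNormal s k ∈ hull s := fun r hr =>
    hball (by simpa [norm_smul, norm_unitNormal] using hr)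
  have hinner : ∀ r : ℝ, inner ℝ (unitNormal s k) (c + r • unitNormal s k - s.points k) =
      inner ℝ (unitNormal s k) (c - s.points k) + r := fun r => by
    rw [add_sub_right_comm, inner_add_right, real_inner_smul_right, real_inner_self_eq_norm_sq,
      norm_unitNormal, one_pow, mul_one]
  have hle := (inner_unitNormal_sub_mem_Icc s (hmem ρ (abs_of_nonneg hρ).le) k).2
  have hnonneg :=
    (inner_unitNormal_sub_mem_Icc s (hmem (-ρ) (by rw [abs_neg, abs_of_nonneg hρ])) k).1
  rw [hinner] at hle hnonneg
  linarith

theorem orthogonal_altitudeFoot_sub (k : Fin (d + 1)) :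
    (ℝ ∙ (s.altitudeFoot k - s.points k))ᗮ = vectorSpan ℝ (s.points '' {k}ᶜ) := by
  have haltitude :=
    congr_arg AffineSubspace.direction (s.affineSpan_pair_altitudeFoot_eq_altitude k)
  rw [Affine.Simplex.direction_altitude, direction_affineSpan, vectorSpan_pair,
    ← direction_affineSpan ℝ (Set.range s.points), s.span_eq_top finrank_euclideanSpace_fin,
    AffineSubspace.direction_top, inf_top_eq, vsub_eq_sub] at haltitude
  rw [haltitude, Submodule.orthogonal_orthogonal]

theorem mk'_orthogonal_altitudeFoot_sub (k : Fin (d + 1)) (t : ℝ) :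
    AffineSubspace.mk' (t • (s.altitudeFoot k - s.points k) +ᵥ s.points k)
        (ℝ ∙ (s.altitudeFoot k - s.points k))ᗮ =
      (affineSpan ℝ (s.points '' {k}ᶜ)).shift (s.points k) t := by
  rw [orthogonal_altitudeFoot_sub, ← direction_affineSpan,
    ← AffineSubspace.direction_shift _ (s.points k) t]
  refine AffineSubspace.mk'_eq ?_
  rw [AffineSubspace.shift_eq ⟨_, s.altitudeFoot_mem_affineSpan_image_compl k⟩]
  refine ⟨_, s.altitudeFoot_mem_affineSpan_image_compl k, ?_⟩
  simp only [AffineEquiv.coe_toAffineMap, AffineEquiv.constVAdd_apply, vadd_eq_add, vsub_eq_sub]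
  module

theorem euclideanHausdorffMeasure_hull_inter_shift (k : Fin (d + 1)) {t : ℝ} (ht : t ≠ 0) :
    μHE[d - 1] (hull s ∩ (affineSpan ℝ (s.points '' {k}ᶜ)).shift (s.points k) t) =
      (Set.Ioc (0 : ℝ) 1).indicator (fun r => ENNReal.ofReal (r ^ (d - 1))) t *
        μHE[d - 1] (faceHull s k) := by
  rw [hull, Affine.Simplex.convexHull_eq_closedInterior, faceHull_eq_closedInterior]
  by_cases hmem : t ∈ Set.Ioc (0 : ℝ) 1
  · rw [s.closedInterior_inter_shift_eq_homothety k (Set.Ioc_subset_Icc_self hmem),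
      euclideanHausdorffMeasure_homothety_image _ _ ht, Set.indicator_of_mem hmem,
      ENNReal.smul_def, smul_eq_mul, ENNReal.ofReal_pow hmem.1.le,
      ← Real.enorm_of_nonneg hmem.1.le, ENNReal.coe_pow, enorm_eq_nnnorm]
  · have ht' : t < 0 ∨ 1 < t := by
      rw [Set.mem_Ioc, not_and_or, not_lt, not_le] at hmem
      exact hmem.imp_left fun h => lt_of_le_of_ne h ht
    rw [(s.disjoint_closedInterior_shift k ht').inter_eq, Set.indicator_of_notMem hmem,
      measure_empty, zero_mul]

theorem lintegral_indicator_Ioc_pow (m : ℕ) :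
    ∫⁻ t, (Set.Ioc (0 : ℝ) 1).indicator (fun r => ENNReal.ofReal (r ^ m)) t =
      ENNReal.ofReal (m + 1)⁻¹ := by
  rw [lintegral_indicator measurableSet_Ioc, ← ofReal_integral_eq_lintegral_ofReal,
    ← intervalIntegral.integral_of_le zero_le_one, integral_pow]
  · simp
  · exact (continuous_pow _).integrableOn_Ioc
  · filter_upwards [ae_restrict_mem measurableSet_Ioc] with t ht
    exact pow_nonneg ht.1.le _

theorem volume_hull_eq (k : Fin (d + 1)) :
    volume (hull s) = ENNReal.ofReal (height s k / d) * μHE[d - 1] (faceHull s k) := by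
  have hv : s.altitudeFoot k - s.points k ≠ 0 := sub_ne_zero.2 (s.ne_altitudeFoot k).symm
  have hslice := EuclideanGeometry.euclideanHausdorffMeasure_eq_lintegral (s.points k) hv
    (measurableSet_hull s)
  rw [finrank_euclideanSpace_fin, EuclideanSpace.euclideanHausdorffMeasure_eq_volume,
    ← ofReal_norm, norm_altitudeFoot_sub] at hslice
  have hsection : ∀ᵐ t : ℝ, μHE[d - 1] (hull s ∩
      AffineSubspace.mk' (t • (s.altitudeFoot k - s.points k) +ᵥ s.points k)
        (ℝ ∙ (s.altitudeFoot k - s.points k))ᗮ) =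
      (Set.Ioc (0 : ℝ) 1).indicator (fun r => ENNReal.ofReal (r ^ (d - 1))) t *
        μHE[d - 1] (faceHull s k) := by
    filter_upwards [Measure.ae_ne volume 0] with t ht
    rw [mk'_orthogonal_altitudeFoot_sub, euclideanHausdorffMeasure_hull_inter_shift s k ht]
  have hmeas : Measurable fun t : ℝ =>
      (Set.Ioc (0 : ℝ) 1).indicator (fun r => ENNReal.ofReal (r ^ (d - 1))) t :=
    (by fun_prop : Measurable fun r : ℝ => ENNReal.ofReal (r ^ (d - 1))).indicator measurableSet_Ioc
  rw [hslice, lintegral_congr_ae hsection, lintegral_mul_const _ hmeas,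
    lintegral_indicator_Ioc_pow, ← mul_assoc, ← ENNReal.ofReal_mul (height_pos s k).le,
    ← Nat.cast_add_one, Nat.sub_add_cancel NeZero.one_le, div_eq_mul_inv]

end Simplex

section Overlap

variable {d : ℕ} {s s₁ s₂ s₃ : Affine.Simplex ℝ (Eu d) d} {k k₁ k₂ k₃ : Fin (d + 1)}

theorem coord_apply_face_eq_zero (h : s₁.points '' {k₁}ᶜ = s₂.points '' {k₂}ᶜ) {j : Fin (d + 1)}
    (hj : j ≠ k₂) : (vertexBasis s₁).coord k₁ (s₂.points j) = 0 := by
  obtain ⟨i, hi, hij⟩ : s₂.points j ∈ s₁.points '' {k₁}ᶜ := h ▸ ⟨j, hj, rfl⟩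
  rw [← hij, ← vertexBasis_apply s₁, (vertexBasis s₁).coord_apply_ne (Ne.symm hi)]

theorem coord_eq_mul_coord (h : s₁.points '' {k₁}ᶜ = s₂.points '' {k₂}ᶜ) (x : Eu d) :
    (vertexBasis s₁).coord k₁ x =
      (vertexBasis s₂).coord k₂ x * (vertexBasis s₁).coord k₁ (s₂.points k₂) := by
  have heq : (vertexBasis s₁).coord k₁ =
      (vertexBasis s₁).coord k₁ (s₂.points k₂) • (vertexBasis s₂).coord k₂ := by
    refine AffineMap.ext_on (vertexBasis s₂).tot ?_
    rintro _ ⟨j, rfl⟩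
    rw [AffineMap.coe_smul, Pi.smul_apply, smul_eq_mul]
    rcases eq_or_ne j k₂ with rfl | hj
    · rw [AffineBasis.coord_apply_eq, mul_one, vertexBasis_apply]
    · rw [AffineBasis.coord_apply_ne _ hj.symm, mul_zero, vertexBasis_apply,
        coord_apply_face_eq_zero h hj]
  rw [mul_comm]
  exact DFunLike.congr_fun heq x

theorem eventually_lineMap_mem_interior_hull {x v : Eu d}
    (h : ∀ i, 0 < (vertexBasis s).coord i x ∨
      (vertexBasis s).coord i x = 0 ∧ 0 < (vertexBasis s).coord i v) :
    ∀ᶠ ε in nhdsWithin (0 : ℝ) (Set.Ioi 0), AffineMap.lineMap x v ε ∈ interior (hull s) := by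
  simp only [interior_hull, Set.mem_ofPred_eq, AffineMap.apply_lineMap]
  refine Filter.eventually_all.2 fun i => ?_
  rcases h i with hx | ⟨hx, hv⟩
  · have hcont : ContinuousAt (AffineMap.lineMap ((vertexBasis s).coord i x)
        ((vertexBasis s).coord i v) : ℝ → ℝ) 0 := AffineMap.lineMap_continuous.continuousAt
    exact nhdsWithin_le_nhds (hcont.eventually_const_lt (by rwa [AffineMap.lineMap_apply_zero]))
  · filter_upwards [self_mem_nhdsWithin] with ε hε
    rw [hx, AffineMap.lineMap_apply_ring', sub_zero, add_zero]
    exact mul_pos hε hv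

section

variable [NeZero d]

theorem coord_faceOppositeCentroid_self (s : Affine.Simplex ℝ (Eu d) d) (k : Fin (d + 1)) :
    (vertexBasis s).coord k (s.faceOppositeCentroid k) = 0 := by
  rw [s.faceOppositeCentroid_eq_affineCombination]
  exact (vertexBasis s).coord_apply_combination_of_notMem (by simp)
    (by simp [Finset.card_compl, NeZero.ne d])

theorem coord_faceOppositeCentroid_pos (s : Affine.Simplex ℝ (Eu d) d) {i : Fin (d + 1)}
    (hi : i ≠ k) : 0 < (vertexBasis s).coord i (s.faceOppositeCentroid k) := by
  have hcoord : (vertexBasis s).coord i (s.faceOppositeCentroid k) = (d : ℝ)⁻¹ := by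
    rw [s.faceOppositeCentroid_eq_affineCombination]
    exact (vertexBasis s).coord_apply_combination_of_mem (by simpa using hi)
      (by simp [Finset.card_compl, NeZero.ne d])
  rw [hcoord, inv_pos, Nat.cast_pos]
  exact Nat.pos_of_neZero d

theorem not_disjoint_interior_hull_of_coord_pos (h : s₁.points '' {k₁}ᶜ = s₂.points '' {k₂}ᶜ)
    (hpos : 0 < (vertexBasis s₁).coord k₁ (s₂.points k₂)) :
    ¬ Disjoint (interior (hull s₁)) (interior (hull s₂)) := by
  -- The centroid of the common face, moved towards the vertex `k₂` of `s₂`, is interior to both.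
  have hcentroid : s₁.faceOppositeCentroid k₁ = s₂.faceOppositeCentroid k₂ :=
    Affine.Simplex.centroid_eq_of_range_eq
      (by rwa [Affine.Simplex.range_faceOpposite_points, Affine.Simplex.range_faceOpposite_points])
  have hside : ∀ s : Affine.Simplex ℝ (Eu d) d, ∀ k, 0 < (vertexBasis s).coord k (s₂.points k₂) →
      ∀ i, 0 < (vertexBasis s).coord i (s.faceOppositeCentroid k) ∨
        (vertexBasis s).coord i (s.faceOppositeCentroid k) = 0 ∧
          0 < (vertexBasis s).coord i (s₂.points k₂) := by
    intro s k hk i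
    rcases eq_or_ne i k with rfl | hi
    · exact Or.inr ⟨coord_faceOppositeCentroid_self s i, hk⟩
    · exact Or.inl (coord_faceOppositeCentroid_pos s hi)
  have hpos₂ : 0 < (vertexBasis s₂).coord k₂ (s₂.points k₂) := by
    rw [← vertexBasis_apply s₂, AffineBasis.coord_apply_eq]
    exact one_pos
  have h₁ := eventually_lineMap_mem_interior_hull (hside s₁ k₁ hpos)
  have h₂ := eventually_lineMap_mem_interior_hull (hside s₂ k₂ hpos₂)
  rw [hcentroid] at h₁
  obtain ⟨ε, hε⟩ := (h₁.and h₂).exists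
  exact Set.not_disjoint_iff.2 ⟨_, hε⟩

theorem not_three_disjoint_of_common_face (h₂ : s₁.points '' {k₁}ᶜ = s₂.points '' {k₂}ᶜ)
    (h₃ : s₁.points '' {k₁}ᶜ = s₃.points '' {k₃}ᶜ)
    (h₁₂ : Disjoint (interior (hull s₁)) (interior (hull s₂)))
    (h₁₃ : Disjoint (interior (hull s₁)) (interior (hull s₃))) :
    ¬ Disjoint (interior (hull s₂)) (interior (hull s₃)) := by
  intro h₂₃
  have hc₁₂ : (vertexBasis s₁).coord k₁ (s₂.points k₂) ≤ 0 :=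
    not_lt.1 fun h => not_disjoint_interior_hull_of_coord_pos h₂ h h₁₂
  have hc₁₃ : (vertexBasis s₁).coord k₁ (s₃.points k₃) ≤ 0 :=
    not_lt.1 fun h => not_disjoint_interior_hull_of_coord_pos h₃ h h₁₃
  have hc₂₃ : (vertexBasis s₂).coord k₂ (s₃.points k₃) ≤ 0 :=
    not_lt.1 fun h => not_disjoint_interior_hull_of_coord_pos (h₂.symm.trans h₃) h h₂₃
  have hnonneg : 0 ≤ (vertexBasis s₁).coord k₁ (s₃.points k₃) := by
    rw [coord_eq_mul_coord h₂ (s₃.points k₃)]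
    exact mul_nonneg_of_nonpos_of_nonpos hc₂₃ hc₁₂
  have hone := coord_eq_mul_coord h₃ (s₁.points k₁)
  rw [← vertexBasis_apply s₁, AffineBasis.coord_apply_eq, le_antisymm hc₁₃ hnonneg,
    mul_zero] at hone
  exact one_ne_zero hone

end

theorem aedisjoint_hull (h : Disjoint (interior (hull s₁)) (interior (hull s₂))) :
    AEDisjoint volume (hull s₁) (hull s₂) := by
  have hinterior : ∀ s : Affine.Simplex ℝ (Eu d) d, hull s =ᵐ[volume] interior (hull s) := fun _ =>
    (interior_ae_eq_of_null_frontier ((convex_convexHull ℝ _).addHaar_frontier volume)).symm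
  exact h.aedisjoint.congr (hinterior s₁) (hinterior s₂)

end Overlap

theorem sum_measureReal_inter {α ι : Type*} [MeasurableSpace α] {μ : Measure α} {V : Set α}
    (hV : μ V ≠ ⊤) (hVm : MeasurableSet V) {F : Finset ι} {A : ι → Set α}
    (hA : ∀ i ∈ F, MeasurableSet (A i))
    (hd : ∀ i ∈ F, ∀ j ∈ F, i ≠ j → AEDisjoint μ (A i) (A j)) (hcov : V ⊆ ⋃ i ∈ F, A i) :
    ∑ i ∈ F, μ.real (V ∩ A i) = μ.real V := by
  rw [← measureReal_biUnion_finset₀, ← Set.inter_iUnion₂, Set.inter_eq_self_of_subset_left hcov]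
  · exact fun i hi j hj hij =>
      (hd i hi j hj hij).mono Set.inter_subset_right Set.inter_subset_right
  · exact fun i hi => (hVm.inter (hA i hi)).nullMeasurableSet

namespace Grid

variable {n : ℕ} {M : Grid n}

section Divergence

theorem faceSet_eq (f : M.Face) :
    M.faceSet f = M.chart (M.sub f.1) '' faceHull (M.simplex f.1) f.2 :=
  ((M.chart (M.sub f.1)).toAffineMap.image_convexHull _).symm

theorem isCompact_faceSet (f : M.Face) : IsCompact (M.faceSet f) :=
  (((Set.toFinite _).image _).image _).isCompact_convexHull ℝ

theorem isCompact_closedCell (T : M.Cell) : IsCompact (M.closedCell T) :=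
  (isCompact_hull _).image (M.chart _).continuous

/-- The area of a face of an element of dimension `d`: its `(d - 1)`-dimensional Hausdorff
measure, normalized to agree with Lebesgue measure on `(d - 1)`-dimensional subspaces. -/
def faceArea (f : M.Face) : ℝ := (μHE[M.cdim f.1 - 1] (M.faceSet f)).toReal

theorem faceSet_eq_empty {f : M.Face} (hf : M.cdim f.1 = 0) : M.faceSet f = ∅ := by
  have : Subsingleton (Fin (M.dim (M.sub f.1) + 1)) :=
    Fin.subsingleton_iff_le_one.2 (Nat.succ_le_succ hf.le)
  have hcompl : ({f.2}ᶜ : Set (Fin (M.dim (M.sub f.1) + 1))) = ∅ :=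
    Set.compl_empty_iff.2 (Set.eq_univ_of_forall fun j => Subsingleton.elim j f.2)
  rw [faceSet, faceVerts, hcompl, Set.image_empty, Set.image_empty, convexHull_empty]

theorem faceArea_eq (f : M.Face) :
    faceArea f = M.cdim f.1 * (height (M.simplex f.1) f.2)⁻¹ *
      volume.real (hull (M.simplex f.1)) := by
  rcases Nat.eq_zero_or_pos (M.cdim f.1) with hd | hd
  · rw [faceArea, faceSet_eq_empty hd, measure_empty, ENNReal.toReal_zero, hd, Nat.cast_zero,
      zero_mul, zero_mul]
  · have : NeZero (M.dim (M.sub f.1)) := ⟨hd.ne'⟩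
    have hheight := height_pos (M.simplex f.1) f.2
    have hd' : (0 : ℝ) < M.dim (M.sub f.1) := Nat.cast_pos.2 hd
    rw [cdim, Measure.real, volume_hull_eq (M.simplex f.1) f.2, ENNReal.toReal_mul, faceArea,
      faceSet_eq, (M.chart (M.sub f.1)).isometry.euclideanHausdorffMeasure_image,
      ENNReal.toReal_ofReal (by positivity), cdim]
    field_simp

theorem faceArea_pos {f : M.Face} (hf : 0 < M.cdim f.1) : 0 < faceArea f := by
  have : NeZero (M.dim (M.sub f.1)) := ⟨hf.ne'⟩
  rw [faceArea_eq]
  exact mul_pos (mul_pos (Nat.cast_pos.2 hf) (inv_pos.2 (height_pos _ _)))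
    (volume_real_hull_pos _)

theorem divergence_field (T : M.Cell) (c : M.Face → ℝ) (x : Eu (M.dim (M.sub T))) :
    divergence (M.field T c) x = M.cdim T * ∑ k, c ⟨T, k⟩ * (height (M.simplex T) k)⁻¹ := by
  have hderiv : HasFDerivAt (M.field T c)
      (∑ k, c ⟨T, k⟩ • (height (M.simplex T) k)⁻¹ •
        ContinuousLinearMap.id ℝ (Eu (M.dim (M.sub T)))) x :=
    HasFDerivAt.fun_sum fun k _ =>
      (((hasFDerivAt_id x).sub_const (M.simplex T |>.points k)).const_smul
        (height (M.simplex T) k)⁻¹).const_smul (c ⟨T, k⟩)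
  have htrace : LinearMap.trace ℝ (Eu (M.dim (M.sub T))) (ContinuousLinearMap.id ℝ _).toLinearMap =
      M.cdim T := by
    rw [ContinuousLinearMap.coe_id, LinearMap.trace_id, finrank_euclideanSpace_fin, cdim]
  simp only [divergence, hderiv.fderiv, ContinuousLinearMap.toLinearMap_sum,
    ContinuousLinearMap.toLinearMap_smul, map_sum, map_smul, htrace, smul_eq_mul, Finset.mul_sum]
  exact Finset.sum_congr rfl fun k _ => by ring

theorem divForm_apply (c : M.Face → ℝ) (p : M.Q) :
    M.divForm c p = ∑ f : M.Face, p f.1 * c f * faceArea f := by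
  rw [Fintype.sum_sigma]
  change ∑ T, ∫ x in hull (M.simplex T), p T * divergence (M.field T c) x = _
  refine Finset.sum_congr rfl fun T _ => ?_
  simp only [divergence_field, setIntegral_const, smul_eq_mul, faceArea_eq, Finset.mul_sum]
  exact Finset.sum_congr rfl fun k _ => by ring

open Classical in
theorem divForm_single (f : M.Face) (p : M.Q) :
    M.divForm (Pi.single f 1) p = p f.1 * faceArea f := by
  rw [divForm_apply, Finset.sum_eq_single f (fun g _ hg => by rw [Pi.single_eq_of_ne hg]; ring)
    (fun hf => absurd (Finset.mem_univ f) hf), Pi.single_eq_same, mul_one]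

end Divergence

section Gluing

theorem exists_simplex_coordinates (f : M.Face) {i : M.Sub} (h : M.sub f.1 = i) :
    ∃ (s : Affine.Simplex ℝ (Eu (M.dim i)) (M.dim i)) (k : Fin (M.dim i + 1)),
      M.openCell f.1 = M.chart i '' interior (hull s) ∧
      M.closedCell f.1 = M.chart i '' hull s ∧
      M.faceVerts f = M.chart i '' (s.points '' {k}ᶜ) := by
  subst h
  exact ⟨M.simplex f.1, f.2, rfl, rfl, rfl⟩

theorem faceVerts_injective (T : M.Cell) :
    Function.Injective fun k => M.faceVerts ⟨T, k⟩ := by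
  intro k k' h
  have himage := (M.simplex T).independent.injective.image_injective
    ((M.chart (M.sub T)).injective.image_injective h)
  rwa [compl_inj_iff, Set.singleton_eq_singleton_iff] at himage

namespace Glued

theorem symm {f g : M.Face} (h : M.Glued f g) : M.Glued g f :=
  ⟨h.1.symm, h.2.1.symm, h.2.2.1.symm, h.2.2.2.2, h.2.2.2.1⟩

theorem faceArea_eq {f g : M.Face} (h : M.Glued f g) : faceArea f = faceArea g := by
  have hdim : M.cdim f.1 = M.cdim g.1 := congrArg M.dim h.2.1
  rw [faceArea, faceArea, faceSet, faceSet, h.2.2.1, hdim]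

theorem cdim_pos (hM : M.IsAdmissible) {f g : M.Face} (h : M.Glued f g) : 0 < M.cdim f.1 := by
  by_contra hdim
  have hdim : M.dim (M.sub f.1) = 0 := Nat.eq_zero_of_not_pos hdim
  have : Subsingleton (Eu (M.dim (M.sub f.1))) := by
    rw [hdim]
    infer_instance
  obtain ⟨s, -, hs, -, -⟩ := exists_simplex_coordinates f rfl
  obtain ⟨t, -, ht, -, -⟩ := exists_simplex_coordinates g h.2.1.symm
  have hdisjoint := hM.disjoint_cells _ _ h.1
  rw [hs, ht, Set.disjoint_image_iff (M.chart _).injective] at hdisjoint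
  obtain ⟨x, hx⟩ := interior_hull_nonempty s
  obtain ⟨y, hy⟩ := interior_hull_nonempty t
  exact Set.disjoint_left.1 hdisjoint hx (Subsingleton.elim y x ▸ hy)

theorem unique (hM : M.IsAdmissible) {f g g' : M.Face} (h : M.Glued f g) (h' : M.Glued f g') :
    g = g' := by
  by_cases hcell : g.1 = g'.1
  · obtain ⟨T, k⟩ := g
    obtain ⟨T', k'⟩ := g'
    obtain rfl : T = T' := hcell
    exact congrArg _ (faceVerts_injective T (h.2.2.1.symm.trans h'.2.2.1))
  · have : NeZero (M.dim (M.sub f.1)) := ⟨(h.cdim_pos hM).ne'⟩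
    have hinj := (M.chart (M.sub f.1)).injective
    obtain ⟨s, k, hs, -, hk⟩ := exists_simplex_coordinates f rfl
    obtain ⟨s₁, k₁, hs₁, -, hk₁⟩ := exists_simplex_coordinates g h.2.1.symm
    obtain ⟨s₂, k₂, hs₂, -, hk₂⟩ := exists_simplex_coordinates g' h'.2.1.symm
    have hd₁ := hM.disjoint_cells _ _ h.1
    have hd₂ := hM.disjoint_cells _ _ h'.1
    have hd₁₂ := hM.disjoint_cells _ _ hcell
    rw [hs, hs₁, Set.disjoint_image_iff hinj] at hd₁
    rw [hs, hs₂, Set.disjoint_image_iff hinj] at hd₂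
    rw [hs₁, hs₂, Set.disjoint_image_iff hinj] at hd₁₂
    exact absurd hd₁₂ (not_three_disjoint_of_common_face
      (hinj.image_injective (hk.symm.trans (h.2.2.1.trans hk₁)))
      (hinj.image_injective (hk.symm.trans (h'.2.2.1.trans hk₂))) hd₁ hd₂)

end Glued

theorem mem_fluxSpace₀_of_ne_zero {c : M.Face → ℝ} (hglued : ∀ f g, M.Glued f g → c f + c g = 0)
    (hc : ∀ f, c f ≠ 0 → f ∉ M.neumann ∧ 0 < M.cdim f.1 ∧ M.faceIfc f = none) :
    c ∈ M.fluxSpace₀ := by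
  refine ⟨⟨hglued, fun f hf => ?_, fun f hf => ?_⟩, fun f hf => ?_⟩ <;> by_contra hne
  · exact (hc f hne).1 hf
  · exact (hc f hne).2.1.ne' hf
  · exact hf (hc f hne).2.2

open Classical in
theorem Glued.single_sub_single_mem_fluxSpace₀ (hM : M.IsAdmissible) {f g : M.Face}
    (h : M.Glued f g) : (Pi.single f 1 - Pi.single g 1 : M.Face → ℝ) ∈ M.fluxSpace₀ := by
  have hfg : f ≠ g := fun e => h.1 (congrArg Sigma.fst e)
  have hsupp : ∀ f' : M.Face, (Pi.single f 1 - Pi.single g 1 : M.Face → ℝ) f' ≠ 0 →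
      f' = f ∨ f' = g := by
    intro f' hf'
    by_contra! hne
    simp [hne] at hf'
  refine mem_fluxSpace₀_of_ne_zero (fun f' g' h' => ?_) fun f' hf' => ?_
  · by_cases hf' : f' = f ∨ f' = g
    · rcases hf' with rfl | rfl
      · obtain rfl := h.unique hM h'
        simp [hfg, hfg.symm]
      · obtain rfl := h.symm.unique hM h'
        simp [hfg, hfg.symm]
    · have hg' : ¬ (g' = f ∨ g' = g) := by
        rintro (rfl | rfl)
        · exact hf' (Or.inr (h'.symm.unique hM h))
        · exact hf' (Or.inl (h'.symm.unique hM h.symm))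
      rw [not_imp_comm.1 (hsupp f') hf', not_imp_comm.1 (hsupp g') hg', add_zero]
  · rcases hsupp f' hf' with rfl | rfl
    · exact ⟨fun hN => (hM.neumann_boundary _ hN).2.2 _ h, h.cdim_pos hM, h.2.2.2.1⟩
    · exact ⟨fun hN => (hM.neumann_boundary _ hN).2.2 _ h.symm, h.symm.cdim_pos hM, h.2.2.2.2⟩

open Classical in
theorem IsBoundary.single_mem_fluxSpace₀ {f : M.Face} (hf : M.IsBoundary f)
    (hN : f ∉ M.neumann) : (Pi.single f 1 : M.Face → ℝ) ∈ M.fluxSpace₀ := by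
  refine mem_fluxSpace₀_of_ne_zero (fun f' g' h' => ?_) fun f' hf' => ?_
  · have hf' : f' ≠ f := fun e => hf.2.2 g' (e ▸ h')
    have hg' : g' ≠ f := fun e => hf.2.2 f' (e ▸ h'.symm)
    rw [Pi.single_eq_of_ne hf', Pi.single_eq_of_ne hg', add_zero]
  · obtain rfl : f' = f := by
      by_contra hne
      exact hf' (Pi.single_eq_of_ne hne _)
    exact ⟨hN, hf.1, hf.2.1⟩

end Gluing

section Surjectivity

variable {p : M.Q}

theorem divForm_eq_zero (hp : M.opB.flip p = 0) {c : M.Face → ℝ} (hc : c ∈ M.fluxSpace₀) :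
    M.divForm c p = 0 := by
  simpa [opB, totalFlux] using LinearMap.congr_fun hp (⟨c, hc⟩, 0)

theorem divForm_ext_add_jumpForm_eq_zero (hp : M.opB.flip p = 0) (μ : M.MortarSpace) :
    M.divForm (M.ext μ) p + M.jumpForm μ p = 0 := by
  have h := LinearMap.congr_fun hp (0, μ)
  rw [← neg_eq_zero]
  simpa [opB, totalFlux] using h

theorem eq_of_glued (hM : M.IsAdmissible) (hp : M.opB.flip p = 0) {f g : M.Face}
    (h : M.Glued f g) : p f.1 = p g.1 := by
  classical
  have hzero := divForm_eq_zero hp (h.single_sub_single_mem_fluxSpace₀ hM)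
  rw [map_sub, LinearMap.sub_apply, divForm_single, divForm_single, ← h.faceArea_eq, ← sub_mul,
    mul_eq_zero, or_iff_left (faceArea_pos (h.cdim_pos hM)).ne', sub_eq_zero] at hzero
  exact hzero

theorem eq_of_sub_eq (hM : M.IsAdmissible) (hp : M.opB.flip p = 0) {S T : M.Cell}
    (h : M.sub S = M.sub T) : p S = p T := by
  induction hM.connected_sub S T h with
  | refl => rfl
  | tail _ hglued ih =>
    obtain ⟨f, g, rfl, rfl, hfg⟩ := hglued
    rw [ih (h.trans hfg.2.1.symm), eq_of_glued hM hp hfg]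

theorem eq_zero_of_dirichlet (hp : M.opB.flip p = 0) {f : M.Face} (hf : M.IsBoundary f)
    (hN : f ∉ M.neumann) : p f.1 = 0 := by
  classical
  have hzero := divForm_eq_zero hp (hf.single_mem_fluxSpace₀ hN)
  rw [divForm_single] at hzero
  exact (mul_eq_zero.1 hzero).resolve_right (faceArea_pos hf.1).ne'

theorem faceSet_subset_range (hM : M.IsAdmissible) {f : M.Face} {j : M.Ifc}
    (h : M.faceIfc f = some j) : M.faceSet f ⊆ Set.range (M.chart (M.lower j)) := by
  have hsubset : M.faceSet f ⊆ M.ifcSet j := by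
    rw [hM.ifcSet_faces]
    exact Set.subset_iUnion₂ (s := fun f (_ : M.faceIfc f = some j) => M.faceSet f) f h
  refine hsubset.trans (Set.iUnion₂_subset fun m hm => ?_)
  subst hm
  exact Set.image_subset_range _ _

theorem volume_preimage_faceSet (hM : M.IsAdmissible) {f : M.Face} {j : M.Ifc}
    (h : M.faceIfc f = some j) :
    volume.real (M.chart (M.lower j) ⁻¹' M.faceSet f) = faceArea f := by
  have hdim : M.cdim f.1 - 1 = M.dim (M.lower j) := by
    rw [cdim, hM.faceIfc_upper f j h, hM.dim_upper, Nat.add_sub_cancel]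
  rw [Measure.real, ← EuclideanSpace.euclideanHausdorffMeasure_eq_volume,
    (M.chart (M.lower j)).isometry.euclideanHausdorffMeasure_preimage,
    Set.inter_eq_self_of_subset_left (faceSet_subset_range hM h), faceArea, hdim]

theorem cdim_pos_of_faceIfc_eq_some (hM : M.IsAdmissible) {f : M.Face} {j : M.Ifc}
    (h : M.faceIfc f = some j) : 0 < M.cdim f.1 := by
  rw [cdim, hM.faceIfc_upper f j h, hM.dim_upper]
  exact Nat.succ_pos _

open Classical in
theorem sum_volume_mortar_inter_face (hM : M.IsAdmissible) (m : M.Mortar) :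
    ∑ f : M.Face with M.faceIfc f = some (M.ifc m),
      volume.real (hull (M.mortarSimplex m) ∩ M.chart (M.lower (M.ifc m)) ⁻¹' M.faceSet f) =
    volume.real (hull (M.mortarSimplex m)) := by
  apply sum_measureReal_inter (volume_hull_ne_top _) (measurableSet_hull _)
  · exact fun f _ => (M.chart _).continuous.measurable (isCompact_faceSet f).measurableSet
  · intro f hf g hg hfg
    exact hM.faces_overlap _ f g (Finset.mem_filter.1 hf).2 (Finset.mem_filter.1 hg).2 hfg
  · intro x hx
    have hmem : M.chart (M.lower (M.ifc m)) x ∈ M.ifcSet (M.ifc m) :=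
      Set.mem_iUnion₂.2 ⟨m, rfl, Set.mem_image_of_mem _ hx⟩
    rw [hM.ifcSet_faces] at hmem
    obtain ⟨f, hf, hxf⟩ := Set.mem_iUnion₂.1 hmem
    exact Set.mem_iUnion₂.2 ⟨f, Finset.mem_filter.2 ⟨Finset.mem_univ _, hf⟩, hxf⟩

open Classical in
theorem sum_volume_mortar_inter_cell (hM : M.IsAdmissible) (m : M.Mortar) :
    ∑ C : M.Cell with M.sub C = M.lower (M.ifc m),
      volume.real (hull (M.mortarSimplex m) ∩ M.chart (M.lower (M.ifc m)) ⁻¹' M.closedCell C) =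
    volume.real (hull (M.mortarSimplex m)) := by
  apply sum_measureReal_inter (volume_hull_ne_top _) (measurableSet_hull _)
  · exact fun C _ => (M.chart _).continuous.measurable (isCompact_closedCell C).measurableSet
  · intro C hC D hD hne
    have hinj := (M.chart (M.lower (M.ifc m))).injective
    obtain ⟨s, -, hso, hsc, -⟩ := exists_simplex_coordinates ⟨C, 0⟩ (Finset.mem_filter.1 hC).2
    obtain ⟨t, -, hto, htc, -⟩ := exists_simplex_coordinates ⟨D, 0⟩ (Finset.mem_filter.1 hD).2
    have hdisjoint := hM.disjoint_cells _ _ hne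
    dsimp only at hso hsc hto htc
    rw [hso, hto, Set.disjoint_image_iff hinj] at hdisjoint
    rw [hsc, htc, Set.preimage_image_eq _ hinj, Set.preimage_image_eq _ hinj]
    exact aedisjoint_hull hdisjoint
  · intro x hx
    have hmem : M.chart (M.lower (M.ifc m)) x ∈ M.ifcSet (M.ifc m) :=
      Set.mem_iUnion₂.2 ⟨m, rfl, Set.mem_image_of_mem _ hx⟩
    obtain ⟨C, hC, hxC⟩ := Set.mem_iUnion₂.1 (hM.ifcSet_lower _ hmem)
    exact Set.mem_iUnion₂.2 ⟨C, Finset.mem_filter.2 ⟨Finset.mem_univ _, hC⟩, hxC⟩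

open Classical in
theorem ext_mul_faceArea (hM : M.IsAdmissible) (μ : M.MortarSpace) (f : M.Face) :
    M.ext μ f * faceArea f = ∑ m : M.Mortar with M.faceIfc f = some (M.ifc m), μ m *
      volume.real (hull (M.mortarSimplex m) ∩
        M.chart (M.lower (M.ifc m)) ⁻¹' M.faceSet f) := by
  change (M.faceIfc f).elim 0 (fun j => M.proj j f μ) * _ = _
  rcases hf : M.faceIfc f with _ | j
  · simp
  · have harea := faceArea_pos (cdim_pos_of_faceIfc_eq_some hM hf)
    simp only [Option.elim_some, Option.some.injEq, eq_comm (a := j)]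
    rw [proj, volume_preimage_faceSet hM hf, div_mul_cancel₀ _ harea.ne']

theorem divForm_ext (hM : M.IsAdmissible) (μ : M.MortarSpace) (q : M.Sub → ℝ) :
    M.divForm (M.ext μ) (q ∘ M.sub) =
      ∑ m, q (M.upper (M.ifc m)) * (μ m * volume.real (hull (M.mortarSimplex m))) := by
  classical
  simp only [divForm_apply, mul_assoc, ext_mul_faceArea hM, Finset.mul_sum, Finset.sum_filter]
  rw [Finset.sum_comm]
  refine Finset.sum_congr rfl fun m _ => ?_
  rw [← sum_volume_mortar_inter_face hM m, Finset.mul_sum, Finset.mul_sum, Finset.sum_filter]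
  refine Finset.sum_congr rfl fun f _ => ?_
  split_ifs with hf
  · rw [Function.comp_apply, hM.faceIfc_upper f _ hf]
  · rw [mul_zero]

theorem jumpForm_comp_sub (hM : M.IsAdmissible) (μ : M.MortarSpace) (q : M.Sub → ℝ) :
    M.jumpForm μ (q ∘ M.sub) =
      -∑ m, q (M.lower (M.ifc m)) * (μ m * volume.real (hull (M.mortarSimplex m))) := by
  classical
  refine congrArg Neg.neg (Finset.sum_congr rfl fun m _ => ?_)
  rw [← sum_volume_mortar_inter_cell hM m, Finset.mul_sum, Finset.mul_sum]
  refine Finset.sum_congr (by congr!) fun C hC => ?_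
  rw [Function.comp_apply, (Finset.mem_filter.1 hC).2]
  ring

theorem eq_of_interface (hM : M.IsAdmissible) {q : M.Sub → ℝ}
    (hq : M.opB.flip (q ∘ M.sub) = 0) (j : M.Ifc) : q (M.lower j) = q (M.upper j) := by
  classical
  obtain ⟨m, rfl⟩ := hM.mortar_nonempty j
  have hzero := divForm_ext_add_jumpForm_eq_zero hq (Pi.single m 1)
  rw [divForm_ext hM, jumpForm_comp_sub hM, ← sub_eq_add_neg, ← Finset.sum_sub_distrib,
    Finset.sum_eq_single m (fun m' _ hm' => by rw [Pi.single_eq_of_ne hm']; ring)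
      (fun hm => absurd (Finset.mem_univ m) hm), Pi.single_eq_same, one_mul, ← sub_mul] at hzero
  exact (sub_eq_zero.1 ((mul_eq_zero.1 hzero).resolve_right (volume_real_hull_pos _).ne')).symm

theorem opB_flip_injective (hM : M.IsAdmissible) : Function.Injective M.opB.flip := by
  rw [injective_iff_map_eq_zero]
  intro p hp
  obtain ⟨q, rfl⟩ : ∃ q : M.Sub → ℝ, p = q ∘ M.sub :=
    (Function.factorsThrough_iff p).1 fun _ _ h => eq_of_sub_eq hM hp h
  have hconst : ∀ i i', q i = q i' := by
    intro i i'
    induction hM.connected i i' with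
    | rel a c h =>
      obtain ⟨j, rfl, rfl⟩ := h
      exact eq_of_interface hM hp j
    | refl => rfl
    | symm _ _ _ ih => exact ih.symm
    | trans _ _ _ _ _ ih ih' => exact ih.trans ih'
  obtain ⟨f, -, hf, hN⟩ := hM.dirichlet
  have hzero : q (M.sub f.1) = 0 := eq_zero_of_dirichlet hp hf hN
  exact funext fun T => (hconst _ _).trans hzero

end Surjectivity

end Grid

section Ellipticity

open Matrix (toEuclideanLin)

theorem IsSPD.apply_sum_self_le {W : Type*} [AddCommGroup W] [Module ℝ W]
    {A : W →ₗ[ℝ] Module.Dual ℝ W} (hA : IsSPD A) {ι : Type*} [Fintype ι] (x : ι → W) :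
    A (∑ i, x i) (∑ i, x i) ≤ Fintype.card ι * ∑ i, A (x i) (x i) := by
  have hpair : ∀ i j, A (x i) (x j) ≤ 2⁻¹ * A (x i) (x i) + 2⁻¹ * A (x j) (x j) := by
    intro i j
    have hnonneg := hA.nonneg (x j - x i)
    rw [hA.apply_sub_self] at hnonneg
    linarith
  simp only [map_sum, LinearMap.coe_sum, Finset.sum_apply]
  refine (Finset.sum_le_sum fun j _ => Finset.sum_le_sum fun i _ => hpair i j).trans_eq ?_
  simp only [Finset.sum_add_distrib, ← Finset.mul_sum, Finset.sum_const, Finset.card_univ,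
    nsmul_eq_mul]
  ring

theorem isSPD_innerₗ (E : Type*) [NormedAddCommGroup E] [InnerProductSpace ℝ E] :
    IsSPD (innerₗ E) :=
  ⟨fun x y => real_inner_comm y x, fun _ hx => real_inner_self_pos.2 hx⟩

variable {d : ℕ} {K : Matrix (Fin d) (Fin d) ℝ}

theorem isSPD_toEuclideanLin (hK : K.PosDef) : IsSPD (innerₗ (Eu d) ∘ₗ toEuclideanLin K) := by
  refine ⟨fun u v => ?_, fun v hv => ?_⟩
  · rw [LinearMap.comp_apply, LinearMap.comp_apply, innerₗ_apply_apply, innerₗ_apply_apply,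
      Matrix.isSymmetric_toEuclideanLin_iff.2 hK.isHermitian u v, real_inner_comm]
  · have hpos := hK.dotProduct_mulVec_pos (x := v.ofLp) (by simpa using hv)
    rw [LinearMap.comp_apply, innerₗ_apply_apply, EuclideanSpace.inner_eq_star_dotProduct,
      Matrix.ofLp_toLpLin, Matrix.toLin'_apply]
    simpa [dotProduct_comm] using hpos

theorem toEuclideanLin_apply_inv (hK : K.PosDef) (v : Eu d) :
    toEuclideanLin K (toEuclideanLin K⁻¹ v) = v := by
  have hdet : IsUnit K.det := (Matrix.isUnit_iff_isUnit_det K).1 hK.isUnit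
  rw [Matrix.toLpLin_apply, Matrix.toLpLin_apply, Matrix.mulVec_mulVec,
    Matrix.mul_nonsing_inv K hdet, Matrix.one_mulVec]

theorem inner_inv_self_le (hK : K.PosDef) {c : ℝ} (hc : 0 < c)
    (hle : ∀ w : Eu d, ‖w‖ ^ 2 ≤ c * inner ℝ (toEuclideanLin K w) w) (v : Eu d) :
    inner ℝ (toEuclideanLin K⁻¹ v) v ≤ c * ‖v‖ ^ 2 := by
  have hdual := (isSPD_innerₗ (Eu d)).dual_le (D := innerₗ (Eu d) ∘ₗ toEuclideanLin K) hc
    (by simpa using hle) (y := toEuclideanLin K⁻¹ v) (z := v)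
    (by rw [LinearMap.comp_apply, toEuclideanLin_apply_inv hK])
  rwa [LinearMap.comp_apply, toEuclideanLin_apply_inv hK, innerₗ_apply_apply, innerₗ_apply_apply,
    real_inner_self_eq_norm_sq, real_inner_comm] at hdual

theorem norm_sq_le_inner_inv_self (hK : K.PosDef) {c : ℝ} (hc : 0 < c)
    (hle : ∀ w : Eu d, inner ℝ (toEuclideanLin K w) w ≤ c * ‖w‖ ^ 2) (v : Eu d) :
    ‖v‖ ^ 2 ≤ c * inner ℝ (toEuclideanLin K⁻¹ v) v := by
  have hdual := (isSPD_toEuclideanLin hK).dual_le (D := innerₗ (Eu d)) hc (by simpa using hle)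
    (y := v) (z := toEuclideanLin K⁻¹ v)
    (by rw [LinearMap.comp_apply, toEuclideanLin_apply_inv hK])
  rwa [LinearMap.comp_apply, toEuclideanLin_apply_inv hK, innerₗ_apply_apply, innerₗ_apply_apply,
    real_inner_self_eq_norm_sq, real_inner_comm] at hdual

theorem exists_ellipticity_inv (hK : K.PosDef) {κ : ℝ}
    (haniso : ∀ u v : Eu d, inner ℝ (toEuclideanLin K u) u * ‖v‖ ^ 2 ≤
      κ * inner ℝ (toEuclideanLin K v) v * ‖u‖ ^ 2) :
    ∃ α : ℝ, 0 < α ∧ ∀ v : Eu d, α * ‖v‖ ^ 2 ≤ inner ℝ (toEuclideanLin K⁻¹ v) v ∧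
      inner ℝ (toEuclideanLin K⁻¹ v) v ≤ κ ^ 2 * α * ‖v‖ ^ 2 := by
  rcases subsingleton_or_nontrivial (Eu d) with hsub | hnontriv
  · exact ⟨1, one_pos, fun v => by simp [Subsingleton.elim v 0]⟩
  obtain ⟨e, he⟩ := exists_norm_eq (Eu d) zero_le_one
  set r := inner ℝ (toEuclideanLin K e) e
  have hr : 0 < r := (isSPD_toEuclideanLin hK).pos e (norm_ne_zero_iff.1 (by simp [he]))
  have hupper : ∀ w : Eu d, inner ℝ (toEuclideanLin K w) w ≤ κ * r * ‖w‖ ^ 2 := fun w => by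
    simpa [he] using haniso w e
  have hlower : ∀ w : Eu d, ‖w‖ ^ 2 ≤ κ / r * inner ℝ (toEuclideanLin K w) w := fun w => by
    rw [div_mul_eq_mul_div, le_div_iff₀ hr, mul_comm]
    simpa [he] using haniso e w
  have hκ : 0 < κ := by
    refine pos_of_mul_pos_left (b := r) (hr.trans_le ?_) hr.le
    simpa [he] using hupper e
  refine ⟨(κ * r)⁻¹, by positivity, fun v => ⟨?_, ?_⟩⟩
  · rw [inv_mul_le_iff₀ (by positivity)]
    exact norm_sq_le_inner_inv_self hK (by positivity) hupper v
  · have hcoeff : κ ^ 2 * (κ * r)⁻¹ = κ / r := by field_simp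
    rw [hcoeff]
    exact inner_inv_self_le hK (by positivity) hlower v

end Ellipticity

section Element

theorem exists_closedBall_add_mul_le_norm {E : Type*} [NormedAddCommGroup E] [NormedSpace ℝ E]
    [Nontrivial E] (w c : E) (t : ℝ) {ρ : ℝ} (hρ : 0 ≤ ρ) :
    ∃ c', Metric.closedBall c' (ρ / 4) ⊆ Metric.closedBall c ρ ∧
      ∀ x ∈ Metric.closedBall c' (ρ / 4), ‖w‖ + |t| * (ρ / 4) ≤ ‖w + t • (x - c)‖ := by
  obtain ⟨e, he, hwe⟩ : ∃ e : E, ‖e‖ = 1 ∧ w = ‖w‖ • e := by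
    rcases eq_or_ne w 0 with rfl | hw
    · obtain ⟨e, he⟩ := exists_norm_eq E zero_le_one
      exact ⟨e, he, by simp⟩
    · exact ⟨‖w‖⁻¹ • w, by simp [norm_smul, hw], by simp [smul_smul, hw]⟩
  obtain ⟨ε, hε, htε⟩ : ∃ ε : ℝ, |ε| = 1 ∧ t * ε = |t| := by
    rcases le_total 0 t with ht | ht
    · exact ⟨1, by simp, by rw [mul_one, abs_of_nonneg ht]⟩
    · exact ⟨-1, by simp, by rw [mul_neg_one, abs_of_nonpos ht]⟩
  -- The center is moved by `ρ / 2` in the direction `± w` in which `w` and `t • (x - c)` add up.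
  set c' : E := c + (ε * (ρ / 2)) • e with hc'
  have hdist : dist c' c = ρ / 2 := by
    rw [dist_eq_norm, hc', add_sub_cancel_left, norm_smul, he, mul_one, Real.norm_eq_abs, abs_mul,
      hε, one_mul, abs_of_nonneg (by linarith)]
  refine ⟨c', Metric.closedBall_subset_closedBall' (by rw [hdist]; linarith), fun x hx => ?_⟩
  have hcenter : ‖w + t • (c' - c)‖ = ‖w‖ + |t| * (ρ / 2) := by
    rw [hc', add_sub_cancel_left, smul_smul, ← mul_assoc, htε]
    nth_rewrite 1 [hwe]
    rw [← add_smul, norm_smul, he, mul_one, Real.norm_of_nonneg (by positivity)]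
  have hmove : ‖w + t • (c' - c)‖ ≤ ‖w + t • (x - c)‖ + |t| * (ρ / 4) := by
    have hsplit : w + t • (c' - c) = w + t • (x - c) + t • (c' - x) := by module
    rw [hsplit]
    refine (norm_add_le _ _).trans ?_
    rw [norm_smul, Real.norm_eq_abs, ← dist_eq_norm, dist_comm]
    have hxc' := Metric.mem_closedBall.1 hx
    gcongr
  linarith

variable {d : ℕ} {s : Affine.Simplex ℝ (Eu d) d}

theorem continuous_rtBasis (k : Fin (d + 1)) : Continuous (rtBasis s k) := by
  unfold rtBasis
  fun_prop

theorem sum_smul_rtBasis_eq_add (a : Fin (d + 1) → ℝ) (x y : Eu d) :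
    ∑ j, a j • rtBasis s j x =
      ∑ j, a j • rtBasis s j y + (∑ j, a j * (height s j)⁻¹) • (x - y) := by
  rw [Finset.sum_smul, ← Finset.sum_add_distrib]
  refine Finset.sum_congr rfl fun j _ => ?_
  rw [rtBasis, rtBasis]
  module

theorem continuous_sum_smul_rtBasis (a : Fin (d + 1) → ℝ) :
    Continuous fun x => ∑ j, a j • rtBasis s j x :=
  continuous_finsetSum _ fun j _ => (continuous_rtBasis j).fun_const_smul (a j)

theorem dist_le_diam_hull {x y : Eu d} (hx : x ∈ hull s) (hy : y ∈ hull s) :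
    dist x y ≤ Metric.diam (hull s) :=
  Metric.dist_le_diam_of_mem (Grid.isCompact_hull s).isBounded hx hy

theorem points_mem_hull (k : Fin (d + 1)) : s.points k ∈ hull s :=
  subset_convexHull ℝ _ ⟨k, rfl⟩

variable {c : Eu d} {ρ σ : ℝ}

theorem nonneg_of_diam_hull_le (hρ : 0 < ρ) (hdiam : Metric.diam (hull s) ≤ σ * ρ) : 0 ≤ σ :=
  nonneg_of_mul_nonneg_left (Metric.diam_nonneg.trans hdiam) hρ

theorem volume_real_hull_le (hρ : 0 < ρ) (hball : Metric.closedBall c ρ ⊆ hull s)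
    (hdiam : Metric.diam (hull s) ≤ σ * ρ) :
    volume.real (hull s) ≤
      max 1 (4 * σ) ^ d * volume.real (Metric.closedBall c (ρ / 4)) := by
  have hσ := nonneg_of_diam_hull_le hρ hdiam
  have hsub : hull s ⊆ Metric.closedBall c (4 * σ * (ρ / 4)) := by
    intro x hx
    have hdist := dist_le_diam_hull hx (hball (Metric.mem_closedBall_self hρ.le))
    rw [Metric.mem_closedBall]
    linarith
  calc volume.real (hull s) ≤ volume.real (Metric.closedBall c (4 * σ * (ρ / 4))) :=
        measureReal_mono hsub (isCompact_closedBall _ _).measure_lt_top.ne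
    _ = (4 * σ) ^ d * volume.real (Metric.closedBall c (ρ / 4)) := by
        rw [Measure.real, Measure.addHaar_closedBall_mul _ _ (by positivity) (by positivity),
          finrank_euclideanSpace_fin, ENNReal.toReal_mul, ENNReal.toReal_ofReal (by positivity),
          Measure.real, Measure.addHaar_closedBall_center _ c]
    _ ≤ _ := by
        gcongr
        exact le_max_right _ _

variable [NeZero d]

theorem inner_unitNormal_sum_smul_rtBasis (a : Fin (d + 1) → ℝ) {i k : Fin (d + 1)}
    (hi : i ≠ k) : inner ℝ (unitNormal s k) (∑ j, a j • rtBasis s j (s.points i)) = a k := by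
  rw [inner_sum, Finset.sum_eq_single k]
  · rw [real_inner_smul_right, rtBasis, real_inner_smul_right, inner_unitNormal_sub s hi,
      inv_mul_cancel₀ (height_pos s k).ne', mul_one]
  · intro j _ hj
    rw [real_inner_smul_right, rtBasis, real_inner_smul_right,
      ← sub_sub_sub_cancel_right _ _ (s.points k), inner_sub_right, inner_unitNormal_sub s hi,
      inner_unitNormal_sub s hj, sub_self, mul_zero, mul_zero]
  · simp

theorem abs_coeff_le_norm_add (a : Fin (d + 1) → ℝ) (hc : c ∈ hull s)
    (k : Fin (d + 1)) : |a k| ≤ ‖∑ j, a j • rtBasis s j c‖ +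
      |∑ j, a j * (height s j)⁻¹| * Metric.diam (hull s) := by
  obtain ⟨i, hi⟩ := exists_ne k
  calc |a k| = |inner ℝ (unitNormal s k) (∑ j, a j • rtBasis s j (s.points i))| := by
        rw [inner_unitNormal_sum_smul_rtBasis a hi]
    _ ≤ ‖∑ j, a j • rtBasis s j (s.points i)‖ := by
        refine (abs_real_inner_le_norm _ _).trans_eq ?_
        rw [norm_unitNormal, one_mul]
    _ ≤ ‖∑ j, a j • rtBasis s j c‖ +
          |∑ j, a j * (height s j)⁻¹| * dist (s.points i) c := by
        rw [sum_smul_rtBasis_eq_add a (s.points i) c]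
        refine (norm_add_le _ _).trans_eq ?_
        rw [norm_smul, Real.norm_eq_abs, dist_eq_norm]
    _ ≤ _ := by
        gcongr
        exact dist_le_diam_hull (points_mem_hull i) hc

theorem exists_closedBall_abs_coeff_le (hρ : 0 < ρ) (hball : Metric.closedBall c ρ ⊆ hull s)
    (hdiam : Metric.diam (hull s) ≤ σ * ρ) (a : Fin (d + 1) → ℝ) :
    ∃ c', Metric.closedBall c' (ρ / 4) ⊆ hull s ∧ ∀ x ∈ Metric.closedBall c' (ρ / 4), ∀ k,
      |a k| ≤ max 1 (4 * σ) * ‖∑ j, a j • rtBasis s j x‖ := by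
  have hc : c ∈ hull s := hball (Metric.mem_closedBall_self hρ.le)
  set t := ∑ j, a j * (height s j)⁻¹
  set w := ∑ j, a j • rtBasis s j c
  obtain ⟨c', hsub, hlower⟩ := exists_closedBall_add_mul_le_norm w c t hρ.le
  refine ⟨c', hsub.trans hball, fun x hx k => ?_⟩
  calc |a k| ≤ ‖w‖ + |t| * Metric.diam (hull s) := abs_coeff_le_norm_add a hc k
    _ ≤ ‖w‖ + |t| * (σ * ρ) := by gcongr
    _ = 1 * ‖w‖ + 4 * σ * (|t| * (ρ / 4)) := by ring
    _ ≤ max 1 (4 * σ) * ‖w‖ + max 1 (4 * σ) * (|t| * (ρ / 4)) := by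
        gcongr
        · exact le_max_left _ _
        · exact le_max_right _ _
    _ = max 1 (4 * σ) * (‖w‖ + |t| * (ρ / 4)) := by ring
    _ ≤ max 1 (4 * σ) * ‖w + t • (x - c)‖ := by
        gcongr
        exact hlower x hx
    _ = _ := by rw [sum_smul_rtBasis_eq_add a x c]

theorem sq_coeff_mul_volume_le (hρ : 0 < ρ) (hball : Metric.closedBall c ρ ⊆ hull s)
    (hdiam : Metric.diam (hull s) ≤ σ * ρ) (a : Fin (d + 1) → ℝ) (k : Fin (d + 1)) :
    a k ^ 2 * volume.real (Metric.closedBall c (ρ / 4)) ≤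
      max 1 (4 * σ) ^ 2 * ∫ x in hull s, ‖∑ j, a j • rtBasis s j x‖ ^ 2 := by
  obtain ⟨c', hsub, hcoeff⟩ := exists_closedBall_abs_coeff_le hρ hball hdiam a
  have hint : IntegrableOn (fun x => ‖∑ j, a j • rtBasis s j x‖ ^ 2) (hull s) :=
    ((continuous_sum_smul_rtBasis a).norm.pow 2).continuousOn.integrableOn_compact
      (Grid.isCompact_hull s)
  calc a k ^ 2 * volume.real (Metric.closedBall c (ρ / 4))
      = ∫ _ in Metric.closedBall c' (ρ / 4), a k ^ 2 := by
        rw [setIntegral_const, smul_eq_mul, mul_comm, Measure.real, Measure.real,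
          Measure.addHaar_closedBall_center _ c, Measure.addHaar_closedBall_center _ c']
    _ ≤ ∫ x in Metric.closedBall c' (ρ / 4),
          max 1 (4 * σ) ^ 2 * ‖∑ j, a j • rtBasis s j x‖ ^ 2 := by
        refine setIntegral_mono_on
          (continuousOn_const.integrableOn_compact (isCompact_closedBall _ _))
          ((hint.mono_set hsub).const_mul _) measurableSet_closedBall fun x hx => ?_
        rw [← sq_abs, ← mul_pow]
        gcongr
        exact hcoeff x hx k
    _ = max 1 (4 * σ) ^ 2 * ∫ x in Metric.closedBall c' (ρ / 4),
          ‖∑ j, a j • rtBasis s j x‖ ^ 2 := integral_const_mul _ _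
    _ ≤ _ := by
        gcongr
        exact ae_of_all _ fun _ => sq_nonneg _

theorem norm_rtBasis_le (hρ : 0 < ρ) (hball : Metric.closedBall c ρ ⊆ hull s)
    (hdiam : Metric.diam (hull s) ≤ σ * ρ) {x : Eu d} (hx : x ∈ hull s) (k : Fin (d + 1)) :
    ‖rtBasis s k x‖ ≤ max 1 (4 * σ) := by
  have hσ := nonneg_of_diam_hull_le hρ hdiam
  have hheight := two_mul_le_height s hρ.le hball k
  have hdist := (dist_le_diam_hull hx (points_mem_hull k)).trans hdiam
  refine le_max_of_le_right ?_
  rw [rtBasis, norm_smul, norm_inv, Real.norm_of_nonneg (height_pos s k).le, ← dist_eq_norm,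
    inv_mul_le_iff₀ (height_pos s k)]
  nlinarith

theorem integral_norm_sq_rtBasis_le (hρ : 0 < ρ) (hball : Metric.closedBall c ρ ⊆ hull s)
    (hdiam : Metric.diam (hull s) ≤ σ * ρ) (k : Fin (d + 1)) :
    ∫ x in hull s, ‖rtBasis s k x‖ ^ 2 ≤
      max 1 (4 * σ) ^ (d + 2) * volume.real (Metric.closedBall c (ρ / 4)) := by
  calc ∫ x in hull s, ‖rtBasis s k x‖ ^ 2 ≤ ∫ _ in hull s, max 1 (4 * σ) ^ 2 := by
        refine setIntegral_mono_on
          (((continuous_rtBasis k).norm.pow 2).continuousOn.integrableOn_compact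
            (Grid.isCompact_hull s))
          (continuousOn_const.integrableOn_compact (Grid.isCompact_hull s))
          (measurableSet_hull s) fun x hx => ?_
        gcongr
        exact norm_rtBasis_le hρ hball hdiam hx k
    _ = volume.real (hull s) * max 1 (4 * σ) ^ 2 := by rw [setIntegral_const, smul_eq_mul]
    _ ≤ max 1 (4 * σ) ^ d * volume.real (Metric.closedBall c (ρ / 4)) * max 1 (4 * σ) ^ 2 := by
        gcongr
        exact volume_real_hull_le hρ hball hdiam
    _ = _ := by ring

theorem sum_sq_coeff_mul_integral_le (hρ : 0 < ρ) (hball : Metric.closedBall c ρ ⊆ hull s)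
    (hdiam : Metric.diam (hull s) ≤ σ * ρ) (a : Fin (d + 1) → ℝ) :
    ∑ k, a k ^ 2 * ∫ x in hull s, ‖rtBasis s k x‖ ^ 2 ≤
      (d + 1) * max 1 (4 * σ) ^ (d + 4) * ∫ x in hull s, ‖∑ j, a j • rtBasis s j x‖ ^ 2 := by
  set I := ∫ x in hull s, ‖∑ j, a j • rtBasis s j x‖ ^ 2
  set τ := max 1 (4 * σ)
  have hτ : 0 ≤ τ := zero_le_one.trans (le_max_left _ _)
  have hterm : ∀ k, a k ^ 2 * ∫ x in hull s, ‖rtBasis s k x‖ ^ 2 ≤ τ ^ (d + 4) * I := fun k =>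
    calc _ ≤ a k ^ 2 * (τ ^ (d + 2) * volume.real (Metric.closedBall c (ρ / 4))) := by
          gcongr
          exact integral_norm_sq_rtBasis_le hρ hball hdiam k
      _ = τ ^ (d + 2) * (a k ^ 2 * volume.real (Metric.closedBall c (ρ / 4))) := by ring
      _ ≤ τ ^ (d + 2) * (τ ^ 2 * I) := by
          exact mul_le_mul_of_nonneg_left (sq_coeff_mul_volume_le hρ hball hdiam a k)
            (pow_nonneg hτ _)
      _ = _ := by ring
  refine (Finset.sum_le_sum fun k _ => hterm k).trans_eq ?_
  rw [Finset.sum_const, Finset.card_univ, Fintype.card_fin, nsmul_eq_mul, Nat.cast_add_one,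
    mul_assoc]

end Element

namespace Grid

section Operators

variable {n : ℕ} {M : Grid n}

theorem cdim_le (T : M.Cell) : M.cdim T ≤ n := by
  simpa [cdim] using LinearMap.finrank_le_finrank_of_injective
    (f := (M.chart (M.sub T)).toAffineMap.linear)
    ((AffineMap.linear_injective_iff _).2 (M.chart (M.sub T)).injective)

theorem continuous_field (T : M.Cell) (c : M.Face → ℝ) : Continuous (M.field T c) :=
  (field_contDiff T c).continuous

theorem exists_mem_hull_field_ne_zero {c : M.Face → ℝ} {f : M.Face} (hf : 0 < M.cdim f.1)
    (hcf : c f ≠ 0) : ∃ x ∈ hull (M.simplex f.1), M.field f.1 c x ≠ 0 := by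
  have : NeZero (M.dim (M.sub f.1)) := ⟨hf.ne'⟩
  obtain ⟨i, hi⟩ := exists_ne f.2
  refine ⟨(M.simplex f.1).points i, points_mem_hull i, fun hzero => hcf ?_⟩
  have hcoeff := inner_unitNormal_sum_smul_rtBasis (s := M.simplex f.1) (fun k => c ⟨f.1, k⟩) hi
  rw [← hcoeff, show ∑ j, _ = (0 : Eu _) from hzero, inner_zero_right]

theorem totalFlux_mk_zero (u : M.fluxSpace₀) : M.totalFlux (u, 0) = u := by simp [totalFlux]

namespace Params

variable (P : M.Params)

theorem isSPD_invK (i : M.Sub) : IsSPD (innerₗ (Eu (M.dim i)) ∘ₗ P.invK i) :=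
  isSPD_toEuclideanLin (P.K_posDef i).inv

theorem inner_invK_nonneg (i : M.Sub) (v : Eu (M.dim i)) : 0 ≤ inner ℝ (P.invK i v) v :=
  (P.isSPD_invK i).nonneg v

theorem continuous_inner_invK (i : M.Sub) :
    Continuous fun v : Eu (M.dim i) => inner ℝ (P.invK i v) v :=
  (LinearMap.continuous_of_finiteDimensional (P.invK i)).inner continuous_id

theorem integrableOn_inner_invK (i : M.Sub) (s : Affine.Simplex ℝ (Eu (M.dim i)) (M.dim i))
    {v : Eu (M.dim i) → Eu (M.dim i)} (hv : Continuous v) :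
    IntegrableOn (fun x => inner ℝ (P.invK i (v x)) (v x)) (hull s) :=
  ((P.continuous_inner_invK i).comp hv).continuousOn.integrableOn_compact (isCompact_hull s)

theorem mass_apply (c c' : M.Face → ℝ) : P.mass c c' = ∑ T, ∫ x in hull (M.simplex T),
    inner ℝ (P.invK (M.sub T) (M.field T c x)) (M.field T c' x) := rfl

theorem massD_apply (c c' : M.Face → ℝ) : P.massD c c' =
    ∑ T, ∑ k, c ⟨T, k⟩ * c' ⟨T, k⟩ * ∫ x in hull (M.simplex T),
      inner ℝ (P.invK (M.sub T) (rtBasis (M.simplex T) k x)) (rtBasis (M.simplex T) k x) := rfl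

theorem mortarMass_apply (l μ : M.MortarSpace) : P.mortarMass l μ =
    ∑ m, P.γ (M.ifc m) * (P.Kν (M.ifc m))⁻¹ * (l m * μ m) *
      volume.real (hull (M.mortarSimplex m)) := rfl

theorem opA_apply (w r : M.W) : P.opA w r =
    P.mass (M.totalFlux w) (M.totalFlux r) + P.mortarMass w.2 r.2 := rfl

theorem opDA_apply (w r : M.W) : P.opDA w r =
    P.massD (M.totalFlux w) (M.totalFlux r) + P.mortarMass w.2 r.2 := rfl

theorem mass_comm (c c' : M.Face → ℝ) : P.mass c c' = P.mass c' c := by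
  rw [mass_apply, mass_apply]
  exact Finset.sum_congr rfl fun T _ => integral_congr_ae (ae_of_all _ fun x =>
    (P.isSPD_invK (M.sub T)).symm (M.field T c x) (M.field T c' x))

theorem massD_comm (c c' : M.Face → ℝ) : P.massD c c' = P.massD c' c := by
  simp only [massD_apply, mul_comm (c _) (c' _)]

theorem mortarMass_comm (l μ : M.MortarSpace) : P.mortarMass l μ = P.mortarMass μ l := by
  simp only [mortarMass_apply, mul_comm (l _) (μ _)]

theorem mass_nonneg (c : M.Face → ℝ) : 0 ≤ P.mass c c :=
  Finset.sum_nonneg fun _ _ => integral_nonneg fun _ => P.inner_invK_nonneg _ _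

theorem mass_pos {c : M.Face → ℝ} {f : M.Face} (hf : 0 < M.cdim f.1) (hcf : c f ≠ 0) :
    0 < P.mass c c := by
  obtain ⟨y, hy, hne⟩ := exists_mem_hull_field_ne_zero hf hcf
  exact Finset.sum_pos' (fun _ _ => integral_nonneg fun _ => P.inner_invK_nonneg _ _)
    ⟨f.1, Finset.mem_univ _, setIntegral_hull_pos _
      ((P.continuous_inner_invK _).comp (continuous_field f.1 c))
      (fun _ => P.inner_invK_nonneg _ _) hy ((P.isSPD_invK _).pos _ hne).ne'⟩

theorem mortarMass_weight_pos (m : M.Mortar) : 0 < P.γ (M.ifc m) * (P.Kν (M.ifc m))⁻¹ :=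
  mul_pos (P.γ_pos _) (inv_pos.2 (P.Kν_pos _))

theorem mortarMass_nonneg (l : M.MortarSpace) : 0 ≤ P.mortarMass l l :=
  Finset.sum_nonneg fun m _ => mul_nonneg
    (mul_nonneg (P.mortarMass_weight_pos m).le (mul_self_nonneg _)) measureReal_nonneg

theorem mortarMass_pos {l : M.MortarSpace} (hl : l ≠ 0) : 0 < P.mortarMass l l := by
  obtain ⟨m, hm⟩ := Function.ne_iff.1 hl
  exact Finset.sum_pos'
    (fun m _ => mul_nonneg
      (mul_nonneg (P.mortarMass_weight_pos m).le (mul_self_nonneg _)) measureReal_nonneg)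
    ⟨m, Finset.mem_univ m, mul_pos
      (mul_pos (P.mortarMass_weight_pos m) (mul_self_pos.2 hm)) (volume_real_hull_pos _)⟩

theorem inner_invK_field_le (T : M.Cell) (c : M.Face → ℝ) (x : Eu (M.dim (M.sub T))) :
    inner ℝ (P.invK (M.sub T) (M.field T c x)) (M.field T c x) ≤
      (n + 1) * ∑ k, c ⟨T, k⟩ * c ⟨T, k⟩ *
        inner ℝ (P.invK (M.sub T) (rtBasis (M.simplex T) k x)) (rtBasis (M.simplex T) k x) := by
  have hsum := (P.isSPD_invK (M.sub T)).apply_sum_self_le fun k =>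
    c ⟨T, k⟩ • rtBasis (M.simplex T) k x
  simp only [map_smul, LinearMap.smul_apply, smul_eq_mul, ← mul_assoc] at hsum
  have hdim : (M.dim (M.sub T) : ℝ) ≤ n := Nat.cast_le.2 (cdim_le T)
  refine hsum.trans (mul_le_mul_of_nonneg_right ?_ (Finset.sum_nonneg fun k _ =>
    mul_nonneg (mul_self_nonneg _) (P.inner_invK_nonneg _ _)))
  rw [Fintype.card_fin, Nat.cast_add_one]
  linarith

theorem mass_le_massD (c : M.Face → ℝ) : P.mass c c ≤ (n + 1) * P.massD c c := by
  rw [mass_apply, massD_apply, Finset.mul_sum]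
  refine Finset.sum_le_sum fun T _ => ?_
  have hint : ∀ k, IntegrableOn (fun x => c ⟨T, k⟩ * c ⟨T, k⟩ *
      inner ℝ (P.invK (M.sub T) (rtBasis (M.simplex T) k x)) (rtBasis (M.simplex T) k x))
      (hull (M.simplex T)) := fun k =>
    (P.integrableOn_inner_invK _ _ (continuous_rtBasis k)).const_mul _
  calc _ ≤ ∫ x in hull (M.simplex T), ((n : ℝ) + 1) * ∑ k, c ⟨T, k⟩ * c ⟨T, k⟩ *
        inner ℝ (P.invK (M.sub T) (rtBasis (M.simplex T) k x)) (rtBasis (M.simplex T) k x) :=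
        setIntegral_mono_on (P.integrableOn_inner T c c)
          ((integrable_finsetSum _ fun k _ => hint k).const_mul _) (measurableSet_hull _)
          fun x _ => P.inner_invK_field_le T c x
    _ = _ := by
        rw [integral_const_mul, integral_finsetSum _ fun k _ => hint k]
        simp only [integral_const_mul]

theorem isSPD_opA : IsSPD P.opA := by
  refine ⟨fun w r => by rw [opA_apply, opA_apply, mass_comm, mortarMass_comm], ?_⟩
  rintro ⟨u, l⟩ hw
  rw [opA_apply]
  rcases eq_or_ne l 0 with rfl | hl
  · have hu : (u : M.Face → ℝ) ≠ 0 := fun hu => hw (Prod.ext (Subtype.ext hu) rfl)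
    obtain ⟨f, hf⟩ := Function.ne_iff.1 hu
    have hdim : 0 < M.cdim f.1 := Nat.pos_of_ne_zero fun hdim => hf (u.2.1.2.2 f hdim)
    rw [totalFlux_mk_zero]
    exact add_pos_of_pos_of_nonneg (P.mass_pos hdim hf) (P.mortarMass_nonneg _)
  · exact add_pos_of_nonneg_of_pos (P.mass_nonneg _) (P.mortarMass_pos hl)

theorem opA_le_opDA (w : M.W) : P.opA w w ≤ (n + 1) * P.opDA w w := by
  rw [opA_apply, opDA_apply, mul_add]
  exact add_le_add (P.mass_le_massD _)
    (le_mul_of_one_le_left (P.mortarMass_nonneg _) (le_add_of_nonneg_left n.cast_nonneg))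

theorem isSPD_opDA : IsSPD P.opDA :=
  ⟨fun w r => by rw [opDA_apply, opDA_apply, massD_comm, mortarMass_comm], fun w hw =>
    pos_of_mul_pos_right ((P.isSPD_opA.pos w hw).trans_le (P.opA_le_opDA w)) (by positivity)⟩

variable {P} {σ κ : ℝ}

theorem sum_sq_mul_integral_norm_sq_le (hσ : M.ShapeRegular σ) (T : M.Cell) (c : M.Face → ℝ) :
    ∑ k, c ⟨T, k⟩ ^ 2 * ∫ x in hull (M.simplex T), ‖rtBasis (M.simplex T) k x‖ ^ 2 ≤
      (n + 1) * max 1 (4 * σ) ^ (n + 4) * ∫ x in hull (M.simplex T), ‖M.field T c x‖ ^ 2 := by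
  rcases Nat.eq_zero_or_pos (M.dim (M.sub T)) with hd | hd
  · have : IsEmpty (Fin (M.dim (M.sub T))) := by rw [hd]; infer_instance
    simp [Subsingleton.elim (rtBasis (M.simplex T) _ _) 0, Subsingleton.elim (M.field T c _) 0]
  · have : NeZero (M.dim (M.sub T)) := ⟨hd.ne'⟩
    obtain ⟨b, ρ, hρ, hball, hdiam⟩ := hσ T
    refine (sum_sq_coeff_mul_integral_le hρ hball hdiam fun k => c ⟨T, k⟩).trans ?_
    have hdim : M.dim (M.sub T) ≤ n := cdim_le T
    refine mul_le_mul_of_nonneg_right ?_ (integral_nonneg fun _ => sq_nonneg _)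
    gcongr
    exact le_max_left _ _

theorem massD_le_mass (hσ : M.ShapeRegular σ) (hK : P.AnisotropyLE κ) (c : M.Face → ℝ) :
    P.massD c c ≤ (n + 1) * max 1 (4 * σ) ^ (n + 4) * κ ^ 2 * P.mass c c := by
  rw [mass_apply, massD_apply, Finset.mul_sum]
  refine Finset.sum_le_sum fun T _ => ?_
  obtain ⟨α, hα, hbound⟩ := exists_ellipticity_inv (P.K_posDef (M.sub T)) (hK (M.sub T))
  have hlower : α * ∫ x in hull (M.simplex T), ‖M.field T c x‖ ^ 2 ≤
      ∫ x in hull (M.simplex T), inner ℝ (P.invK (M.sub T) (M.field T c x)) (M.field T c x) := by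
    rw [← integral_const_mul]
    exact setIntegral_mono_on (((continuous_const.mul ((continuous_field T c).norm.pow 2)
      ).continuousOn.integrableOn_compact (isCompact_hull _)))
      (P.integrableOn_inner T c c) (measurableSet_hull _) fun x _ => (hbound _).1
  have hupper : ∀ k, ∫ x in hull (M.simplex T),
      inner ℝ (P.invK (M.sub T) (rtBasis (M.simplex T) k x)) (rtBasis (M.simplex T) k x) ≤
      κ ^ 2 * α * ∫ x in hull (M.simplex T), ‖rtBasis (M.simplex T) k x‖ ^ 2 := fun k => by
    rw [← integral_const_mul]
    exact setIntegral_mono_on (P.integrableOn_inner_invK _ _ (continuous_rtBasis k))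
      ((continuous_const.mul ((continuous_rtBasis k).norm.pow 2)
      ).continuousOn.integrableOn_compact (isCompact_hull _)) (measurableSet_hull _)
      fun x _ => (hbound _).2
  calc _ ≤ ∑ k, c ⟨T, k⟩ ^ 2 *
        (κ ^ 2 * α * ∫ x in hull (M.simplex T), ‖rtBasis (M.simplex T) k x‖ ^ 2) := by
        simp only [← sq]
        gcongr
        exact hupper _
    _ = κ ^ 2 * α *
        ∑ k, c ⟨T, k⟩ ^ 2 * ∫ x in hull (M.simplex T), ‖rtBasis (M.simplex T) k x‖ ^ 2 := by
        simp only [Finset.mul_sum, mul_left_comm]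
    _ ≤ κ ^ 2 * α * ((n + 1) * max 1 (4 * σ) ^ (n + 4) *
          ∫ x in hull (M.simplex T), ‖M.field T c x‖ ^ 2) := by
        gcongr
        exact sum_sq_mul_integral_norm_sq_le hσ T c
    _ = (n + 1) * max 1 (4 * σ) ^ (n + 4) * κ ^ 2 *
          (α * ∫ x in hull (M.simplex T), ‖M.field T c x‖ ^ 2) := by ring
    _ ≤ _ := by gcongr

theorem opDA_le_opA (hσ : M.ShapeRegular σ) (hK : P.AnisotropyLE κ) (w : M.W) :
    P.opDA w w ≤ (1 + (n + 1) * max 1 (4 * σ) ^ (n + 4) * κ ^ 2) * P.opA w w := by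
  have hC : 0 ≤ (n + 1) * max 1 (4 * σ) ^ (n + 4) * κ ^ 2 := by positivity
  have hmass := massD_le_mass hσ hK (M.totalFlux w)
  have hnonneg := P.mass_nonneg (M.totalFlux w)
  have hmortar := mul_nonneg hC (P.mortarMass_nonneg w.2)
  rw [opA_apply, opDA_apply]
  linarith

end Params

end Operators

end Grid

end MixedDim

end

theorem mainTheorem8_general (n : ℕ) :
    ∃ ξ₁ : ℝ, 0 < ξ₁ ∧
      (∀ M : MixedDim.Grid n, M.IsAdmissible → ∀ P : M.Params,
        Function.Bijective P.opDA ∧ Function.Bijective P.blockD ∧ Function.Bijective P.blockU ∧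
        (∀ x' y', MixedDim.dualInner P.calBD x' y' = MixedDim.dualInner P.calBD y' x') ∧
        (∀ x', x' ≠ 0 → 0 < MixedDim.dualInner P.calBD x' x') ∧
        ∀ x : M.W × M.Q, x ≠ 0 → ∀ x', x' = P.blockU x →
          ξ₁ ≤ MixedDim.dualInner P.calBD (P.calA (P.calBU x')) x' /
              MixedDim.dualInner P.calBD x' x') ∧
      ∀ σ κ : ℝ, ∃ ξ₂ : ℝ, 0 < ξ₂ ∧
        ∀ M : MixedDim.Grid n, M.IsAdmissible → M.ShapeRegular σ →
        ∀ P : M.Params, P.AnisotropyLE κ →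
        ∀ x : M.W × M.Q, x ≠ 0 → ∀ x', x' = P.blockU x →
          MixedDim.dualNorm P.calBD (P.calA (P.calBU x')) / MixedDim.dualNorm P.calBD x' ≤ ξ₂ := by
  refine ⟨(2 * (1 + ((n : ℝ) + 1)))⁻¹, by positivity, fun M hM P => ?_, fun σ κ =>
    ⟨1 + 2 * (1 + (n + 1) * max 1 (4 * σ) ^ (n + 4) * κ ^ 2), by positivity, ?_⟩⟩
  · have hB := MixedDim.Grid.opB_flip_injective hM
    have hS := P.isSPD_opDA.schurComplement hB
    have hU : Function.Bijective P.blockU := P.isSPD_opA.bijective_block_upper hS _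
    refine ⟨P.isSPD_opDA.bijective, P.isSPD_opA.bijective_block_upper hS 0, hU,
      P.isSPD_opA.dualInner_block_diag_comm hS,
      fun _ => P.isSPD_opA.dualInner_block_diag_pos hS, ?_⟩
    rintro x hx _ rfl
    rw [MixedDim.Grid.Params.calBU, MixedDim.linInv_apply hU]
    exact MixedDim.le_dualInner_saddle_div P.isSPD_opA P.isSPD_opDA hB (by positivity)
      P.opA_le_opDA hx
  · rintro M hM hσ P hK x hx _ rfl
    have hB := MixedDim.Grid.opB_flip_injective hM
    have hU : Function.Bijective P.blockU :=
      P.isSPD_opA.bijective_block_upper (P.isSPD_opDA.schurComplement hB) _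
    rw [MixedDim.Grid.Params.calBU, MixedDim.linInv_apply hU]
    exact MixedDim.dualNorm_saddle_div_le P.isSPD_opA P.isSPD_opDA hB (by positivity)
      (MixedDim.Grid.Params.opDA_le_opA hσ hK) hx

theorem mainTheorem8 (n : ℕ) (hn : n = 2 ∨ n = 3) (σ : ℝ) :
    ∃ ξ₁ : ℝ, 0 < ξ₁ ∧ ∀ κ : ℝ, ∃ ξ₂ : ℝ, 0 < ξ₂ ∧
      ∀ (M : MixedDim.Grid n), M.IsAdmissible → M.ShapeRegular σ →
      ∀ P : M.Params, P.AnisotropyLE κ →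
        -- the preconditioners are well defined
        Function.Bijective P.opDA ∧ Function.Bijective P.blockD ∧ Function.Bijective P.blockU ∧
        -- `(·, ·)_{B_D}` is an inner product
        (∀ x' y', MixedDim.dualInner P.calBD x' y' = MixedDim.dualInner P.calBD y' x') ∧
        (∀ x', x' ≠ 0 → 0 < MixedDim.dualInner P.calBD x' x') ∧
        -- the bounds
        ∀ x : M.W × M.Q, x ≠ 0 → ∀ x', x' = P.blockU x →
          ξ₁ ≤ MixedDim.dualInner P.calBD (P.calA (P.calBU x')) x' /
              MixedDim.dualInner P.calBD x' x' ∧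
          MixedDim.dualNorm P.calBD (P.calA (P.calBU x')) / MixedDim.dualNorm P.calBD x' ≤ ξ₂ := by
  obtain ⟨ξ₁, hξ₁, hwell, hupper⟩ := mainTheorem8_general n
  refine ⟨ξ₁, hξ₁, fun κ => ?_⟩
  obtain ⟨ξ₂, hξ₂, hbound⟩ := hupper σ κ
  refine ⟨ξ₂, hξ₂, fun M hM hσ P hK => ?_⟩
  obtain ⟨hDA, hBD, hBU, hcomm, hpos, hlower⟩ := hwell M hM P
  exact ⟨hDA, hBD, hBU, hcomm, hpos, fun x hx x' hx' =>
    ⟨hlower x hx x' hx', hbound M hM hσ P hK x hx x' hx'⟩⟩
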